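/- Let $m\ge 3$ and $k\ge 0$ be integers. Let $\mathcal{C}l_m$ be the real Clifford algebra generated by an orthonormal basis $e_1,\dots,e_m$ of $\mathbb{R}^m$ with $e_ie_j+e_je_i=-2\delta_{ij}$, with the norm $|a|=(\sum_A a_A^2)^{1/2}$ for $a=\sum_A a_Ae_A$, where $A$ runs over the subsets of $\{1,\dots,m\}$; vectors $x\in\mathbb{R}^m$ are identified with $\sum_i x_ie_i$. Let $D_x=\sum_{i=1}^m e_i\partial_{x_i}$ be the Dirac operator and let $\mathcal{M}_k$ be the space of $\mathcal{C}l_m$-valued polynomials $p$ on $\mathbb{R}^m$ that are homogeneous of degree $k$ and satisfy $Dp=0$. Let $\mathbb{B}^m$ be the open unit ball of $\mathbb{R}^m$. For a domain (non-empty connected open set) $\Omega\subset\mathbb{R}^m$, let $C^1(\Omega\times\mathbb{B}^m,\mathcal{M}_k)$ be the set of $C^1$ functions $f:\Omega\times\mathbb{B}^m\to\mathcal{C}l_m$ such that for every $x\in\Omega$ the function $u\mapsto f(x,u)$ is the restriction to $\mathbb{B}^m$ of an element of $\mathcal{M}_k$. For such $f$ the Rarita-Schwinger operator is $$R_kf(x,u)=\Big(1+\frac{u\,D_u}{m+2k-2}\Big)D_xf(x,u).$$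 **Theorem (Cauchy's estimates with $L^\infty$ norm).** Let $\alpha,\beta\in\mathbb{N}_0^m$ be multi-indices. There is a constant $c_{\alpha,\beta,m,k}$, depending only on $\alpha,\beta,m,k$, such that the following holds for every domain $\Omega\subset\mathbb{R}^m$ and every $f\in C^1(\Omega\times\mathbb{B}^m,\mathcal{M}_k)$ with $R_kf=0$ on $\Omega\times\mathbb{B}^m$. The function $f$ is infinitely differentiable on $\Omega\times\mathbb{B}^m$, and for all $y,u\in\mathbb{R}^m$ and $r_1,r_2>0$ with $\overline{B(y,r_1)}\subset\Omega$ and $\overline{B(u,r_2)}\subset\mathbb{B}^m$, $$|D_y^{\alpha}D_u^{\beta}f(y,u)|\le\frac{c_{\alpha,\beta,m,k}\,\|f\|_{L^\infty(B(y,r_1)\times B(u,r_2))}}{r_1^{|\alpha|}\,r_2^{|\beta|}}.$$ Here $D_y^\alpha=\partial_{y_1}^{\alpha_1}\cdots\partial_{y_m}^{\alpha_m}$, $|\alpha|=\alpha_1+\dots+\alpha_m$, likewise for $\beta$, and $B(z,r)$ is the open ball of radius $r$ about $z$. -/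

import Mathlib

open scoped ContDiff symmDiff

namespace RaritaSchwinger

/-! ### The Clifford algebra with its Euclidean norm -/

/-- The Euclidean space `ℝ^m`. -/
abbrev Euc (m : ℕ) : Type := EuclideanSpace ℝ (Fin m)

/-- The quadratic form `x ↦ -|x|²` on `ℝ^m`. -/
noncomputable def negSq (m : ℕ) : QuadraticForm ℝ (Euc m) :=
  -(LinearMap.BilinMap.toQuadraticMap (innerₗ (Euc m)))

/-- The real Clifford algebra, with the relations `e_i e_j + e_j e_i = -2 δ_ij`. -/
abbrev Cl (m : ℕ) : Type := CliffordAlgebra (negSq m)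

/-- The standard basis vector of `ℝ^m`. -/
noncomputable abbrev stdVec {m : ℕ} (i : Fin m) : Euc m := EuclideanSpace.single i (1 : ℝ)

/-- The embedding of `ℝ^m` into the Clifford algebra. -/
noncomputable def toCl {m : ℕ} (x : Euc m) : Cl m := CliffordAlgebra.ι (negSq m) x

/-- The generator `e_i` of the Clifford algebra. -/
noncomputable def gen {m : ℕ} (i : Fin m) : Cl m := toCl (stdVec i)

/-- The basis blade `e_A = e_{i₁} ⋯ e_{i_r}`, where `A = {i₁ < ⋯ < i_r}`. -/
noncomputable def blade {m : ℕ} (A : Finset (Fin m)) : Cl m :=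
  ((A.sort (· ≤ ·)).map gen).prod

theorem negSq_apply {m : ℕ} (x : Euc m) : negSq m x = -∑ i, x i * x i := by
  simp [negSq, LinearMap.BilinMap.toQuadraticMap_apply, EuclideanSpace.real_norm_sq_eq, ← sq]

theorem gen_mul_self {m : ℕ} (i : Fin m) : gen i * gen i = (-1 : Cl m) := by
  simp [gen, toCl, CliffordAlgebra.ι_sq_scalar, negSq_apply]

theorem gen_anticomm {m : ℕ} {i j : Fin m} (h : i ≠ j) :
    gen i * gen j = -(gen j * gen i : Cl m) := by
  rw [eq_neg_iff_add_eq_zero]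
  simp only [gen, toCl, CliffordAlgebra.ι_mul_ι_add_swap, QuadraticMap.polar, negSq_apply]
  have : ∑ x, ((stdVec i + stdVec j) x * (stdVec i + stdVec j) x : ℝ) =
      ∑ x, stdVec i x * stdVec i x + ∑ x, stdVec j x * stdVec j x := by
    rw [← Finset.sum_add_distrib]
    refine Finset.sum_congr rfl fun x _ => ?_
    by_cases hi : x = i
    · subst hi; simp [h]
    · simp [hi]
  rw [this]
  simp

/-- The sign in `e_i e_A = ± e_{A ∆ {i}}`. -/
noncomputable def bladeSign {m : ℕ} (i : Fin m) (A : Finset (Fin m)) : ℝ :=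
  (-1) ^ (A.filter (· ≤ i)).card

theorem blade_empty {m : ℕ} : blade (∅ : Finset (Fin m)) = 1 := by simp [blade]

theorem blade_insert {m : ℕ} {a : Fin m} {A : Finset (Fin m)} (h : ∀ b ∈ A, a < b) :
    blade (insert a A) = gen a * blade A := by
  have h2 : a ∉ A := fun hA => lt_irrefl _ (h a hA)
  simp [blade, Finset.sort_insert (r := (· ≤ ·)) (fun b hb => (h b hb).le) h2]

theorem gen_mul_blade {m : ℕ} (i : Fin m) (A : Finset (Fin m)) :
    gen i * blade A = bladeSign i A • blade (A ∆ {i}) := by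
  induction A using Finset.induction_on_min with
  | empty =>
    have : (∅ : Finset (Fin m)) ∆ {i} = insert i ∅ := by simp
    rw [this, blade_insert (by simp)]
    simp [bladeSign]
  | insert a A hA ih =>
    have ha : a ∉ A := fun h => lt_irrefl _ (hA a h)
    rcases lt_trichotomy i a with hi | hi | hi
    · have hall : ∀ b ∈ insert a A, i < b := by
        intro b hb
        rcases Finset.mem_insert.1 hb with rfl | hb
        · exact hi
        · exact hi.trans (hA b hb)
      have h1 : (insert a A) ∆ {i} = insert i (insert a A) := by
        ext b
        have := hall b
        simp only [Finset.mem_symmDiff, Finset.mem_singleton, Finset.mem_insert] at this ⊢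
        grind
      have h2 : (insert a A).filter (· ≤ i) = ∅ :=
        Finset.filter_eq_empty_iff.2 fun b hb => not_le.2 (hall b hb)
      rw [h1, blade_insert hall]
      simp [bladeSign, h2]
    · subst hi
      have h1 : (insert i A) ∆ {i} = A := by
        ext b
        simp only [Finset.mem_symmDiff, Finset.mem_singleton, Finset.mem_insert]
        grind
      have h2 : (insert i A).filter (· ≤ i) = {i} := by
        ext b
        have := hA b
        simp only [Finset.mem_filter, Finset.mem_singleton, Finset.mem_insert]
        grind
      rw [h1, blade_insert hA, ← mul_assoc, gen_mul_self]
      simp [bladeSign, h2]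
    · have hall : ∀ b ∈ A ∆ {i}, a < b := by
        intro b hb
        have := hA b
        simp only [Finset.mem_symmDiff, Finset.mem_singleton] at hb
        grind
      have h1 : (insert a A) ∆ {i} = insert a (A ∆ {i}) := by
        ext b
        simp only [Finset.mem_symmDiff, Finset.mem_singleton, Finset.mem_insert]
        grind
      have h2 : bladeSign i (insert a A) = -bladeSign i A := by
        rw [bladeSign, Finset.filter_insert, if_pos hi.le, Finset.card_insert_of_notMem
          (by simp [ha]), pow_succ, bladeSign]
        ring
      rw [h1, blade_insert hA, blade_insert hall, ← mul_assoc, gen_anticomm hi.ne', neg_mul,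
        mul_assoc, ih, h2]
      simp

theorem symmDiff_symmDiff_single {m : ℕ} (i : Fin m) (A : Finset (Fin m)) :
    (A ∆ {i}) ∆ {i} = A := by
  rw [symmDiff_assoc, symmDiff_self, symmDiff_bot]

theorem bladeSign_self {m : ℕ} (i : Fin m) (A : Finset (Fin m)) :
    bladeSign i (A ∆ {i}) * bladeSign i A = -1 := by
  by_cases h : i ∈ A
  · have h1 : A = insert i (A ∆ {i}) := by
      ext b
      simp only [Finset.mem_symmDiff, Finset.mem_singleton, Finset.mem_insert]
      grind
    have h2 : i ∉ A ∆ {i} := by simp [Finset.mem_symmDiff, h]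
    generalize A ∆ {i} = B at *
    subst h1
    rw [bladeSign, bladeSign, Finset.filter_insert, if_pos le_rfl,
      Finset.card_insert_of_notMem (by simp [h2]), pow_succ, ← mul_assoc, ← mul_pow]
    simp
  · have h1 : A ∆ {i} = insert i A := by
      ext b
      simp only [Finset.mem_symmDiff, Finset.mem_singleton, Finset.mem_insert]
      grind
    rw [h1, bladeSign, bladeSign, Finset.filter_insert, if_pos le_rfl,
      Finset.card_insert_of_notMem (by simp [h]), pow_succ, mul_right_comm, ← mul_pow]
    simp

theorem bladeSign_of_lt {m : ℕ} {i j : Fin m} (h : i < j) (A : Finset (Fin m)) :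
    bladeSign i (A ∆ {j}) = bladeSign i A := by
  have : (A ∆ {j}).filter (· ≤ i) = A.filter (· ≤ i) := by
    ext b
    simp only [Finset.mem_symmDiff, Finset.mem_singleton, Finset.mem_filter]
    grind
  rw [bladeSign, this, bladeSign]

theorem bladeSign_of_gt {m : ℕ} {i j : Fin m} (h : j < i) (A : Finset (Fin m)) :
    bladeSign i (A ∆ {j}) = -bladeSign i A := by
  by_cases hj : j ∈ A
  · have h1 : A = insert j (A ∆ {j}) := by
      ext b
      simp only [Finset.mem_symmDiff, Finset.mem_singleton, Finset.mem_insert]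
      grind
    have h2 : j ∉ A ∆ {j} := by simp [Finset.mem_symmDiff, hj]
    generalize A ∆ {j} = B at *
    subst h1
    rw [bladeSign, bladeSign, Finset.filter_insert, if_pos h.le,
      Finset.card_insert_of_notMem (by simp [h2]), pow_succ]
    ring
  · have h1 : A ∆ {j} = insert j A := by
      ext b
      simp only [Finset.mem_symmDiff, Finset.mem_singleton, Finset.mem_insert]
      grind
    rw [h1, bladeSign, bladeSign, Finset.filter_insert, if_pos h.le,
      Finset.card_insert_of_notMem (by simp [hj]), pow_succ]
    ring

/-- Left multiplication by `e_i` in coordinates with respect to the blades. -/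
noncomputable def genOp {m : ℕ} (i : Fin m) : Module.End ℝ (Finset (Fin m) → ℝ) where
  toFun g A := bladeSign i (A ∆ {i}) * g (A ∆ {i})
  map_add' g h := by ext A; simp [mul_add]
  map_smul' c g := by ext A; simp [mul_left_comm]

theorem genOp_apply {m : ℕ} (i : Fin m) (g : Finset (Fin m) → ℝ) (A : Finset (Fin m)) :
    genOp i g A = bladeSign i (A ∆ {i}) * g (A ∆ {i}) := rfl

theorem genOp_mul_self {m : ℕ} (i : Fin m) : genOp i * genOp i = (-1 : Module.End ℝ _) := by
  refine LinearMap.ext fun g => funext fun A => ?_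
  simp only [Module.End.mul_apply, genOp_apply, symmDiff_symmDiff_single, LinearMap.neg_apply,
    Module.End.one_apply, Pi.neg_apply, ← mul_assoc, bladeSign_self]
  simp

theorem genOp_anticomm {m : ℕ} {i j : Fin m} (h : i ≠ j) :
    genOp i * genOp j + genOp j * genOp i = 0 := by
  refine LinearMap.ext fun g => funext fun A => ?_
  simp only [Module.End.mul_apply, genOp_apply, LinearMap.add_apply,
    Pi.add_apply, LinearMap.zero_apply, Pi.zero_apply]
  have key : ∀ i j : Fin m, i < j →
      bladeSign i (A ∆ {i}) * (bladeSign j (A ∆ {i} ∆ {j}) * g (A ∆ {i} ∆ {j})) +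
      bladeSign j (A ∆ {j}) * (bladeSign i (A ∆ {j} ∆ {i}) * g (A ∆ {j} ∆ {i})) = 0 := by
    intro i j h
    have h1 : A ∆ {i} ∆ {j} = A ∆ {j} ∆ {i} := symmDiff_right_comm _ _ _
    have h2 : bladeSign j (A ∆ {i} ∆ {j}) = -bladeSign j (A ∆ {j}) := by
      rw [h1, bladeSign_of_gt h]
    have h3 : bladeSign i (A ∆ {j} ∆ {i}) = bladeSign i (A ∆ {i}) := by
      rw [← h1, bladeSign_of_lt h]
    rw [h2, h3, h1]
    ring
  rcases lt_or_gt_of_ne h with h | h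
  · exact key i j h
  · rw [add_comm]; exact key j i h

theorem genOp_single {m : ℕ} (i : Fin m) (A : Finset (Fin m)) :
    genOp i (Pi.single A 1) = bladeSign i A • Pi.single (A ∆ {i}) 1 := by
  funext B
  rw [genOp_apply]
  by_cases h : B = A ∆ {i}
  · subst h; simp
  · have h2 : B ∆ {i} ≠ A := by
      rintro rfl
      exact h (symmDiff_symmDiff_single i B).symm
    simp [h, h2]

/-- Left multiplication by a vector in coordinates with respect to the blades. -/
noncomputable def vecOp (m : ℕ) : Euc m →ₗ[ℝ] Module.End ℝ (Finset (Fin m) → ℝ) where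
  toFun x := ∑ i, x i • genOp i
  map_add' x y := by simp [add_smul, Finset.sum_add_distrib]
  map_smul' c x := by simp [mul_smul, Finset.smul_sum]

theorem vecOp_apply {m : ℕ} (x : Euc m) : vecOp m x = ∑ i, x i • genOp i := rfl

theorem vecOp_sq {m : ℕ} (x : Euc m) :
    vecOp m x * vecOp m x = algebraMap ℝ (Module.End ℝ (Finset (Fin m) → ℝ)) (negSq m x) := by
  have h1 : vecOp m x * vecOp m x = ∑ i, ∑ j, (x i * x j) • (genOp i * genOp j) := by
    rw [vecOp_apply, Finset.sum_mul_sum]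
    simp only [smul_mul_smul_comm]
  have h2 : vecOp m x * vecOp m x = ∑ i, ∑ j, (x i * x j) • (genOp j * genOp i) := by
    rw [h1, Finset.sum_comm]
    exact Finset.sum_congr rfl fun i _ => Finset.sum_congr rfl fun j _ => by rw [mul_comm (x j)]
  have h3 : vecOp m x * vecOp m x + vecOp m x * vecOp m x =
      ∑ i, (-(2 : ℝ) * (x i * x i)) • (1 : Module.End ℝ (Finset (Fin m) → ℝ)) := by
    nth_rewrite 1 [h1]
    rw [h2, ← Finset.sum_add_distrib]
    refine Finset.sum_congr rfl fun i _ => ?_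
    rw [← Finset.sum_add_distrib, Finset.sum_eq_single i]
    · rw [genOp_mul_self, ← smul_add, ← neg_add, smul_neg, ← two_smul ℝ (1 : Module.End ℝ _),
        smul_smul, ← neg_smul]
      congr 1
      ring
    · intro j _ hj
      rw [← smul_add, genOp_anticomm hj.symm, smul_zero]
    · simp
  have h4 : (2 : ℝ) • (vecOp m x * vecOp m x) = (2 : ℝ) •
      algebraMap ℝ (Module.End ℝ (Finset (Fin m) → ℝ)) (negSq m x) := by
    rw [two_smul, h3, ← Finset.sum_smul, ← Finset.mul_sum, negSq_apply,
      Algebra.algebraMap_eq_smul_one, smul_smul]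
    congr 1
    ring
  exact smul_right_injective _ (two_ne_zero' ℝ) h4

/-- The left regular representation in coordinates with respect to the blades. -/
noncomputable def leftRep (m : ℕ) : Cl m →ₐ[ℝ] Module.End ℝ (Finset (Fin m) → ℝ) :=
  CliffordAlgebra.lift (negSq m) ⟨vecOp m, vecOp_sq⟩

theorem leftRep_gen {m : ℕ} (i : Fin m) : leftRep m (gen i) = genOp i := by
  rw [leftRep, gen, toCl, CliffordAlgebra.lift_ι_apply, vecOp_apply, Finset.sum_eq_single i]
  · simp
  · intro j _ hj; simp [hj]
  · simp

/-- The coordinates of a Clifford number with respect to the blades. -/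
noncomputable def bladeCoord (m : ℕ) : Cl m →ₗ[ℝ] (Finset (Fin m) → ℝ) :=
  (LinearMap.applyₗ (Pi.single ∅ 1)).comp (leftRep m).toLinearMap

theorem bladeCoord_apply {m : ℕ} (x : Cl m) :
    bladeCoord m x = leftRep m x (Pi.single ∅ 1) := rfl

theorem bladeCoord_blade {m : ℕ} (A : Finset (Fin m)) :
    bladeCoord m (blade A) = Pi.single A 1 := by
  induction A using Finset.induction_on_min with
  | empty => simp [bladeCoord_apply, blade_empty]
  | insert a A hA ih =>
    have h1 : A ∆ {a} = insert a A := by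
      ext b
      have := hA b
      simp only [Finset.mem_symmDiff, Finset.mem_singleton, Finset.mem_insert]
      grind
    have h2 : A.filter (· ≤ a) = ∅ :=
      Finset.filter_eq_empty_iff.2 fun b hb => not_le.2 (hA b hb)
    rw [bladeCoord_apply] at ih ⊢
    rw [blade_insert hA, map_mul, Module.End.mul_apply, ih, leftRep_gen, genOp_single, h1]
    simp [bladeSign, h2]

/-- The Clifford number with given coordinates. -/
noncomputable def bladeSum (m : ℕ) : (Finset (Fin m) → ℝ) →ₗ[ℝ] Cl m :=
  Fintype.linearCombination ℝ blade

theorem bladeSum_apply {m : ℕ} (g : Finset (Fin m) → ℝ) :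
    bladeSum m g = ∑ A, g A • blade A := rfl

theorem bladeSum_genOp {m : ℕ} (i : Fin m) (g : Finset (Fin m) → ℝ) :
    bladeSum m (genOp i g) = gen i * bladeSum m g := by
  rw [bladeSum_apply, bladeSum_apply, Finset.mul_sum]
  refine Finset.sum_bij' (fun A _ => A ∆ {i}) (fun A _ => A ∆ {i}) (by simp) (by simp)
    (fun A _ => symmDiff_symmDiff_single i A) (fun A _ => symmDiff_symmDiff_single i A) ?_
  intro A _
  rw [genOp_apply, mul_smul_comm, gen_mul_blade, symmDiff_symmDiff_single, smul_smul, mul_comm]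

theorem toCl_eq_sum {m : ℕ} (x : Euc m) : toCl x = ∑ i, x i • gen i := by
  have h : x = ∑ i, x i • stdVec i := by
    ext j
    simp [Finset.sum_apply, Pi.single_apply]
  conv_lhs => rw [h]
  simp [toCl, gen]

theorem bladeSum_leftRep {m : ℕ} (x : Cl m) (g : Finset (Fin m) → ℝ) :
    bladeSum m (leftRep m x g) = x * bladeSum m g := by
  induction x using CliffordAlgebra.induction generalizing g with
  | algebraMap r => simp [Algebra.algebraMap_eq_smul_one]
  | ι v =>
    have : CliffordAlgebra.ι (negSq m) v = ∑ i, v i • gen i := toCl_eq_sum v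
    rw [this]
    simp [leftRep_gen, Finset.sum_mul, bladeSum_genOp]
  | mul a b ha hb => rw [map_mul, Module.End.mul_apply, ha, hb, mul_assoc]
  | add a b ha hb => rw [map_add, LinearMap.add_apply, map_add, ha, hb, add_mul]

theorem bladeSum_bladeCoord {m : ℕ} (x : Cl m) : bladeSum m (bladeCoord m x) = x := by
  rw [bladeCoord_apply, bladeSum_leftRep, bladeSum_apply, Finset.sum_eq_single ∅]
  · simp [blade_empty]
  · intro A _ hA; simp [hA]
  · simp

theorem bladeCoord_bladeSum {m : ℕ} (g : Finset (Fin m) → ℝ) :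
    bladeCoord m (bladeSum m g) = g := by
  rw [bladeSum_apply, map_sum]
  simp only [map_smul, bladeCoord_blade]
  funext B
  simp [Pi.single_apply]

/-- The basis of the Clifford algebra that consists of the `2^m` blades `e_A`. -/
noncomputable def bladeBasis (m : ℕ) : Module.Basis (Finset (Fin m)) ℝ (Cl m) :=
  Module.Basis.ofEquivFun
    (LinearEquiv.ofLinearMap (bladeCoord m) (bladeSum m)
      (LinearMap.ext bladeCoord_bladeSum) (LinearMap.ext bladeSum_bladeCoord))

theorem bladeBasis_apply {m : ℕ} (A : Finset (Fin m)) : bladeBasis m A = blade A := by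
  have h : bladeBasis m A = bladeSum m (Pi.single A 1) := by
    simp [bladeBasis]
  rw [h, ← bladeCoord_blade, bladeSum_bladeCoord]

/-- The coordinates `(x_A)` of `x = ∑ x_A e_A`, as a vector of a Euclidean space. -/
noncomputable def euclCoord (m : ℕ) : Cl m →ₗ[ℝ] EuclideanSpace ℝ (Finset (Fin m)) :=
  (WithLp.linearEquiv 2 ℝ (Finset (Fin m) → ℝ)).symm.toLinearMap.comp
    (bladeBasis m).equivFun.toLinearMap

theorem euclCoord_injective (m : ℕ) : Function.Injective (euclCoord m) :=
  (WithLp.linearEquiv 2 ℝ (Finset (Fin m) → ℝ)).symm.injective.comp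
    (bladeBasis m).equivFun.injective

/-- The norm `|x| = (∑ x_A²)^{1/2}` of `x = ∑ x_A e_A`. -/
noncomputable instance instNormedAddCommGroupCl (m : ℕ) : NormedAddCommGroup (Cl m) :=
  NormedAddCommGroup.induced (Cl m) (EuclideanSpace ℝ (Finset (Fin m))) (euclCoord m)
    (euclCoord_injective m)

noncomputable instance instNormedSpaceCl (m : ℕ) : NormedSpace ℝ (Cl m) :=
  NormedSpace.induced ℝ (Cl m) (EuclideanSpace ℝ (Finset (Fin m))) (euclCoord m)

theorem norm_eq_sqrt {m : ℕ} (x : Cl m) :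
    ‖x‖ = Real.sqrt (∑ A, ((bladeBasis m).repr x A) ^ 2) := by
  change ‖euclCoord m x‖ = _
  rw [EuclideanSpace.norm_eq]
  simp [euclCoord]

/-! ### Monogenic polynomials, the Rarita-Schwinger operator, fermionic functions -/

/-- The partial derivative `∂_i g`. -/
noncomputable def partialDeriv {m : ℕ} (i : Fin m) (g : Euc m → Cl m) : Euc m → Cl m :=
  fun x => lineDeriv ℝ g x (stdVec i)

/-- The derivative `D^α = ∂_1^{α_1} ⋯ ∂_m^{α_m}` for a multi-index `α`. -/
noncomputable def multiDeriv {m : ℕ} (α : Fin m → ℕ) (g : Euc m → Cl m) : Euc m → Cl m :=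
  (List.finRange m).foldr (fun i h => (partialDeriv i)^[α i] h) g

/-- The mixed derivative `D_y^α D_u^β f (y, u)` of a function of two vector variables. -/
noncomputable def mixedDeriv {m : ℕ} (α β : Fin m → ℕ) (f : Euc m × Euc m → Cl m)
    (y u : Euc m) : Cl m :=
  multiDeriv α (fun y' => multiDeriv β (fun u' => f (y', u')) u) y

/-- The Dirac operator `D g = ∑ e_i ∂_i g`. -/
noncomputable def dirac {m : ℕ} (g : Euc m → Cl m) : Euc m → Cl m :=
  fun x => ∑ i, gen i * partialDeriv i g x

/-- `p` is a Clifford-valued polynomial, homogeneous of degree `k`. -/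
def IsHomogPoly {m : ℕ} (k : ℕ) (p : Euc m → Cl m) : Prop :=
  ∃ c : (Fin m → ℕ) → Cl m, ∀ u,
    p u = ∑ γ ∈ Finset.piAntidiag Finset.univ k, (∏ i, u i ^ γ i) • c γ

/-- The space `M_k` of Clifford-valued monogenic polynomials, homogeneous of degree `k`. -/
def monogenicPoly (m k : ℕ) : Set (Euc m → Cl m) :=
  {p | IsHomogPoly k p ∧ ∀ u, dirac p u = 0}

/-- The projection `P_k = 1 + u D_u / (m + 2k - 2)`. -/
noncomputable def fischerProj {m : ℕ} (k : ℕ) (h : Euc m → Cl m) : Euc m → Cl m :=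
  fun u => h u + ((m : ℝ) + 2 * k - 2)⁻¹ • (toCl u * dirac h u)

/-- The Rarita-Schwinger operator `R_k f (x, u) = P_k D_x f (x, u)`. -/
noncomputable def raritaSchwinger {m : ℕ} (k : ℕ) (f : Euc m × Euc m → Cl m)
    (x u : Euc m) : Cl m :=
  fischerProj k (fun u' => dirac (fun x' => f (x', u')) x) u

/-- `f` belongs to `C¹(Ω × 𝔹, M_k)`, where `𝔹` is the open unit ball, and `R_k f = 0` there. -/
structure IsFermionic {m : ℕ} (k : ℕ) (Ω : Set (Euc m)) (f : Euc m × Euc m → Cl m) : Prop where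
  contDiffOn : ContDiffOn ℝ 1 f (Ω ×ˢ Metric.ball 0 1)
  mem_monogenicPoly : ∀ x ∈ Ω, ∃ p ∈ monogenicPoly m k, ∀ u ∈ Metric.ball (0 : Euc m) 1,
    f (x, u) = p u
  raritaSchwinger_eq_zero : ∀ x ∈ Ω, ∀ u ∈ Metric.ball (0 : Euc m) 1, raritaSchwinger k f x u = 0

end RaritaSchwinger

open RaritaSchwinger

/-!
Interior estimates for the Rarita-Schwinger operator follow from the fact that a solution `f` is
polyharmonic in `x` and harmonic in `u`.

**Polyharmonicity.** Write `D_x`, `D_u` for the two Dirac operators, `u` for the multiplication by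
the vector variable, and `L = ⟨∂_u, ∂_x⟩`. Since `D_u f = 0` and `D_u D_x + D_x D_u = -2 L`, the
equation `R_k f = 0` reads `a D_x f = u L f` with `a = (m + 2 k - 2) / 2`. Because
`L u = u L + D_x` and `L` commutes with `D_x`, the function `L f` satisfies the same equation with
`a - 1` in place of `a`, and its degree in `u` is smaller by one. Moreover
`a Δ_x f = -D_x (u L f) = (2 ⟨u, ∂_x⟩ + u D_x) L f`, so induction on the degree gives
`Δ_x^{k+1} f = 0`; the condition `m ≥ 3` keeps all the constants `a, a - 1, …` positive
(`IsDiracSystem.laplacian_pow_eq_zero`). As `f` is only `C¹`, the computation is made for the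
distribution `φ ↦ ∫ f (x, ·) φ (x) dx` with values in the smooth functions of `u`. The dependence
on `u` is made explicit by interpolation, `f (x, u) = ∑ q_j (u) f (x, u_j)` with finitely many
nodes `u_j` in the unit ball (`exists_homogPoly_interpolation`, `evalL_integral_lap_eq_zero`).

**Cauchy estimates.** For a smooth `v` with `Δ^N v = 0`, the radial means of `v` about a point are
polynomials of degree less than `N` in the square of the radius (Pizzetti's formula,
`integral_radial_eq_polynomial`). A linear combination of means over `N` radii therefore recovers
the value at the centre, and mollification carries this over to continuous weak solutions: they are
reproduced by convolution with the dilates of one smooth compactly supported kernel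
(`exists_reproducing_kernel`). This gives smoothness, and estimates with the sup norm whose
constants scale with the radius (`exists_cauchy_estimate`).

The estimate is applied twice: in `u`, where monogenic functions are harmonic, and then in `x` to
`D_u^β f (·, u)`, which is a combination of the functions `f (·, u_j)` with constant real
coefficients and hence again weakly polyharmonic. Each step uses values of `f` on the two balls
only, so no comparison of norms on the space of monogenic polynomials is needed.
-/

namespace RaritaSchwinger

open MeasureTheory Metric Set Filter Topology
open scoped Convolution

variable {m : ℕ} {F : Type*} [NormedAddCommGroup F] [NormedSpace ℝ F]

/-! ### Coordinate derivatives and the Laplacian -/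

/-- The partial derivative `∂_i g` for functions with values in any normed space; it is `0` where
the line derivative does not exist. -/
noncomputable def coordDeriv (i : Fin m) (g : Euc m → F) : Euc m → F :=
  fun x => lineDeriv ℝ g x (stdVec i)

/-- The derivative `D^α` along a list of coordinates, the first one being applied last; for the
list of all coordinates and Clifford-valued functions this is `multiDeriv α`, by definition. -/
noncomputable def iterCoordDeriv (α : Fin m → ℕ) (l : List (Fin m)) (g : Euc m → F) : Euc m → F :=
  l.foldr (fun i h => (coordDeriv i)^[α i] h) g

/-- The Laplacian `∑ ∂_i²`. -/
noncomputable def lap (g : Euc m → F) : Euc m → F :=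
  fun x => ∑ i, coordDeriv i (coordDeriv i g) x

theorem partialDeriv_eq_coordDeriv (i : Fin m) (g : Euc m → Cl m) :
    partialDeriv i g = coordDeriv i g := rfl

/-- A relation between functions that is preserved by all `∂_i` is preserved by `D^α`. The index
`n` of the relation counts the derivatives that have been taken, so that scaling factors can be
tracked. -/
theorem iterCoordDeriv_rel {F' : Type*} [NormedAddCommGroup F'] [NormedSpace ℝ F']
    {R : ℕ → (Euc m → F) → (Euc m → F') → Prop}
    (hR : ∀ n g g' i, R n g g' → R (n + 1) (coordDeriv i g) (coordDeriv i g'))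
    (α : Fin m → ℕ) (l : List (Fin m)) {n : ℕ} {g : Euc m → F} {g' : Euc m → F'} (h : R n g g') :
    R (n + (l.map α).sum) (iterCoordDeriv α l g) (iterCoordDeriv α l g') := by
  have iter : ∀ (i : Fin m) (j n : ℕ) (g : Euc m → F) (g' : Euc m → F'), R n g g' →
      R (n + j) ((coordDeriv i)^[j] g) ((coordDeriv i)^[j] g') := by
    intro i j
    induction j with
    | zero => intro n g g' h; exact h
    | succ j ih =>
      intro n g g' h
      rw [Function.iterate_succ_apply, Function.iterate_succ_apply]
      have := ih _ _ _ (hR _ _ _ i h)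
      rwa [add_assoc, add_comm 1 j] at this
  induction l with
  | nil => exact h
  | cons i l ih =>
    have := iter i (α i) _ _ _ ih
    rw [add_assoc, add_comm _ (α i)] at this
    simpa [iterCoordDeriv] using this

theorem iterCoordDeriv_pred {P : (Euc m → F) → Prop}
    (hP : ∀ g i, P g → P (coordDeriv i g)) (α : Fin m → ℕ) (l : List (Fin m))
    {g : Euc m → F} (h : P g) : P (iterCoordDeriv α l g) :=
  iterCoordDeriv_rel (R := fun _ g _ => P g) (fun _ g _ i => hP g i) α l (n := 0) (g' := g) h

theorem coordDeriv_eq_fderiv {g : Euc m → F} {x : Euc m} (h : DifferentiableAt ℝ g x)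
    (i : Fin m) : coordDeriv i g x = fderiv ℝ g x (stdVec i) :=
  h.lineDeriv_eq_fderiv

theorem contDiff_coordDeriv {g : Euc m → F} (hg : ContDiff ℝ ∞ g) (i : Fin m) :
    ContDiff ℝ ∞ (coordDeriv i g) := by
  have : coordDeriv i g = fun x => fderiv ℝ g x (stdVec i) :=
    funext fun x => coordDeriv_eq_fderiv (hg.differentiable (by simp) x) i
  rw [this]
  exact (hg.fderiv_right (m := ∞) (by simp)).clm_apply contDiff_const

theorem contDiff_iterCoordDeriv {g : Euc m → F} (hg : ContDiff ℝ ∞ g) (α : Fin m → ℕ)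
    (l : List (Fin m)) : ContDiff ℝ ∞ (iterCoordDeriv α l g) :=
  iterCoordDeriv_pred (P := fun g => ContDiff ℝ ∞ g) (fun _ i h => contDiff_coordDeriv h i) α l hg

theorem contDiff_lap {g : Euc m → F} (hg : ContDiff ℝ ∞ g) : ContDiff ℝ ∞ (lap g) :=
  ContDiff.sum fun i _ => contDiff_coordDeriv (contDiff_coordDeriv hg i) i

theorem coordDeriv_congr {g h : Euc m → F} {x : Euc m} (e : g =ᶠ[𝓝 x] h) (i : Fin m) :
    coordDeriv i g x = coordDeriv i h x :=
  e.lineDeriv_eq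

theorem coordDeriv_eventuallyEq {g h : Euc m → F} {x : Euc m} (e : g =ᶠ[𝓝 x] h) (i : Fin m) :
    coordDeriv i g =ᶠ[𝓝 x] coordDeriv i h := by
  filter_upwards [eventually_eventually_nhds.2 e] with y hy using coordDeriv_congr hy i

theorem iterCoordDeriv_eventuallyEq {g h : Euc m → F} {x : Euc m} (e : g =ᶠ[𝓝 x] h)
    (α : Fin m → ℕ) (l : List (Fin m)) : iterCoordDeriv α l g =ᶠ[𝓝 x] iterCoordDeriv α l h :=
  iterCoordDeriv_rel (R := fun _ g h => g =ᶠ[𝓝 x] h)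
    (fun _ _ _ i h => coordDeriv_eventuallyEq h i) α l (n := 0) e

theorem coordDeriv_comm {g : Euc m → F} (hg : ContDiff ℝ ∞ g) (i j : Fin m) :
    coordDeriv i (coordDeriv j g) = coordDeriv j (coordDeriv i g) := by
  have key : ∀ (i j : Fin m) x, coordDeriv i (coordDeriv j g) x =
      fderiv ℝ (fderiv ℝ g) x (stdVec i) (stdVec j) := by
    intro i j x
    have h1 : coordDeriv j g = fun x => fderiv ℝ g x (stdVec j) :=
      funext fun x => coordDeriv_eq_fderiv (hg.differentiable (by simp) x) j
    have h2 : DifferentiableAt ℝ (fderiv ℝ g) x :=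
      ((hg.fderiv_right (m := ∞) (by simp)).differentiable (by simp)) x
    rw [h1, coordDeriv_eq_fderiv (h2.clm_apply (differentiableAt_const _)),
      fderiv_clm_apply h2 (differentiableAt_const _)]
    simp
  funext x
  rw [key, key]
  exact ((hg.of_le (m := 2) (by norm_cast)).contDiffAt.isSymmSndFDerivAt
    (by simp)) _ _

theorem tsupport_coordDeriv_subset (g : Euc m → F) (i : Fin m) :
    tsupport (coordDeriv i g) ⊆ tsupport g := by
  refine closure_minimal (fun x hx => ?_) (isClosed_tsupport g)
  by_contra h
  refine hx ?_
  rw [coordDeriv_congr (notMem_tsupport_iff_eventuallyEq.1 h)]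
  simp [coordDeriv, lineDeriv]

theorem coordDeriv_add {g h : Euc m → F} (hg : Differentiable ℝ g) (hh : Differentiable ℝ h)
    (i : Fin m) : coordDeriv i (g + h) = coordDeriv i g + coordDeriv i h := by
  funext x
  rw [Pi.add_apply, coordDeriv_eq_fderiv ((hg x).add (hh x)), coordDeriv_eq_fderiv (hg x),
    coordDeriv_eq_fderiv (hh x), fderiv_add (hg x) (hh x)]
  rfl

theorem coordDeriv_const_smul (c : ℝ) (g : Euc m → F) (i : Fin m) :
    coordDeriv i (c • g) = c • coordDeriv i g := by
  funext x
  simp only [coordDeriv, lineDeriv, Pi.smul_apply]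
  exact deriv_fun_const_smul_field c _

theorem coordDeriv_comp_smul (c : ℝ) (g : Euc m → F) (i : Fin m) :
    coordDeriv i (fun x => g (c • x)) = c • fun x => coordDeriv i g (c • x) := by
  funext x
  simp only [coordDeriv, lineDeriv, Pi.smul_apply, smul_add, smul_smul]
  have := deriv_comp_mul_left c (fun t : ℝ => g (c • x + t • stdVec i)) 0
  simpa [mul_comm] using this

theorem coordDeriv_comp_sub (g : Euc m → F) (a : Euc m) (i : Fin m) :
    coordDeriv i (fun x => g (a - x)) = -fun x => coordDeriv i g (a - x) := by
  funext x
  simp only [coordDeriv, lineDeriv, Pi.neg_apply]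
  have := deriv_comp_neg (fun t : ℝ => g (a - x + t • stdVec i)) 0
  rw [neg_zero] at this
  rw [← this]
  congr 1
  funext t
  congr 1
  module

theorem lap_comp_sub (g : Euc m → F) (a : Euc m) :
    lap (fun x => g (a - x)) = fun x => lap g (a - x) := by
  funext x
  simp only [lap]
  refine Finset.sum_congr rfl fun i _ => ?_
  have h : coordDeriv i (fun x => g (a - x)) = (-1 : ℝ) • fun x => coordDeriv i g (a - x) := by
    rw [coordDeriv_comp_sub]; simp
  rw [h, coordDeriv_const_smul, coordDeriv_comp_sub]
  simp

theorem lap_iterate_comp_sub (g : Euc m → F) (a : Euc m) (n : ℕ) :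
    lap^[n] (fun x => g (a - x)) = fun x => (lap^[n] g) (a - x) := by
  induction n generalizing g with
  | zero => rfl
  | succ n ih => rw [Function.iterate_succ_apply, lap_comp_sub, ih]; rfl

theorem tsupport_lap_subset (g : Euc m → F) : tsupport (lap g) ⊆ tsupport g := by
  refine closure_minimal (fun x hx => ?_) (isClosed_tsupport g)
  by_contra h
  refine hx (Finset.sum_eq_zero fun i _ => ?_)
  have h1 := fun h' => h (tsupport_coordDeriv_subset g i (tsupport_coordDeriv_subset _ i h'))
  exact image_eq_zero_of_notMem_tsupport h1

theorem tsupport_lap_iterate_subset (g : Euc m → F) (n : ℕ) :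
    tsupport (lap^[n] g) ⊆ tsupport g := by
  induction n generalizing g with
  | zero => exact subset_rfl
  | succ n ih => exact (ih _).trans (tsupport_lap_subset g)

theorem coordDeriv_smul_const {q : Euc m → ℝ} (hq : Differentiable ℝ q) (a : F) (i : Fin m) :
    coordDeriv i (fun x => q x • a) = fun x => coordDeriv i q x • a := by
  funext x
  rw [coordDeriv_eq_fderiv ((hq x).smul_const a), coordDeriv_eq_fderiv (hq x),
    fderiv_smul_const (hq x)]
  rfl

theorem coordDeriv_sum {ι : Type*} {s : Finset ι} {g : ι → Euc m → F} {x : Euc m}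
    (hg : ∀ j ∈ s, DifferentiableAt ℝ (g j) x) (i : Fin m) :
    coordDeriv i (fun x => ∑ j ∈ s, g j x) x = ∑ j ∈ s, coordDeriv i (g j) x := by
  rw [coordDeriv_eq_fderiv (DifferentiableAt.fun_sum hg), fderiv_fun_sum hg]
  simp only [FunLike.coe_sum, Finset.sum_apply]
  exact Finset.sum_congr rfl fun j hj => (coordDeriv_eq_fderiv (hg j hj) i).symm

/-! ### Convolutions -/

theorem hasCompactSupport_coordDeriv {φ : Euc m → F} (hc : HasCompactSupport φ) (i : Fin m) :
    HasCompactSupport (coordDeriv i φ) :=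
  hc.mono' (subset_closure.trans (tsupport_coordDeriv_subset φ i))

theorem coordDeriv_convolution {φ : Euc m → ℝ} (hφ : ContDiff ℝ ∞ φ) (hc : HasCompactSupport φ)
    {G : Euc m → F} (hG : LocallyIntegrable G) (i : Fin m) :
    coordDeriv i (φ ⋆[ContinuousLinearMap.lsmul ℝ ℝ] G) =
      (coordDeriv i φ) ⋆[ContinuousLinearMap.lsmul ℝ ℝ] G := by
  funext x
  have h1 : ContDiff ℝ 1 φ := hφ.of_le (by norm_cast)
  have h := hc.hasFDerivAt_convolution_left (ContinuousLinearMap.lsmul ℝ ℝ) h1 hG x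
  rw [coordDeriv_eq_fderiv h.differentiableAt, h.fderiv]
  have hint : ConvolutionExistsAt (fderiv ℝ φ) G x
      ((ContinuousLinearMap.lsmul ℝ ℝ : ℝ →L[ℝ] F →L[ℝ] F).precompL (Euc m)) volume :=
    (hc.fderiv ℝ).convolutionExists_left _ (h1.continuous_fderiv (by simp)) hG x
  unfold convolution
  rw [ContinuousLinearMap.integral_apply hint]
  refine integral_congr_ae (Eventually.of_forall fun t => ?_)
  beta_reduce
  rw [coordDeriv_eq_fderiv (hφ.differentiable (by simp) t)]
  simp [ContinuousLinearMap.precompL]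

theorem iterCoordDeriv_convolution {φ : Euc m → ℝ} (hφ : ContDiff ℝ ∞ φ)
    (hc : HasCompactSupport φ) {G : Euc m → F} (hG : LocallyIntegrable G) (α : Fin m → ℕ)
    (l : List (Fin m)) :
    iterCoordDeriv α l (φ ⋆[ContinuousLinearMap.lsmul ℝ ℝ] G) =
      (iterCoordDeriv α l φ) ⋆[ContinuousLinearMap.lsmul ℝ ℝ] G :=
  (iterCoordDeriv_rel (n := 0) (R := fun _ (φ : Euc m → ℝ) H => ContDiff ℝ ∞ φ ∧
      HasCompactSupport φ ∧ H = φ ⋆[ContinuousLinearMap.lsmul ℝ ℝ] G)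
    (fun _ φ H i ⟨h1, h2, h3⟩ => ⟨contDiff_coordDeriv h1 i, hasCompactSupport_coordDeriv h2 i,
      by rw [h3, coordDeriv_convolution h1 h2 hG]⟩) α l ⟨hφ, hc, rfl⟩).2.2

theorem lap_convolution {φ : Euc m → ℝ} (hφ : ContDiff ℝ ∞ φ) (hc : HasCompactSupport φ)
    {G : Euc m → F} (hG : LocallyIntegrable G) :
    lap (φ ⋆[ContinuousLinearMap.lsmul ℝ ℝ] G) = (lap φ) ⋆[ContinuousLinearMap.lsmul ℝ ℝ] G := by
  funext x
  simp only [lap]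
  have hi := fun i => coordDeriv_convolution (contDiff_coordDeriv hφ i)
    (hasCompactSupport_coordDeriv hc i) hG i
  have he : ∀ i, ConvolutionExistsAt (coordDeriv i (coordDeriv i φ)) G x
      (ContinuousLinearMap.lsmul ℝ ℝ : ℝ →L[ℝ] F →L[ℝ] F) volume := fun i =>
    (hasCompactSupport_coordDeriv (hasCompactSupport_coordDeriv hc i) i).convolutionExists_left _
      (contDiff_coordDeriv (contDiff_coordDeriv hφ i) i).continuous hG x
  simp_rw [coordDeriv_convolution hφ hc hG, hi]
  unfold convolution
  rw [← integral_finsetSum _ fun i _ => he i]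
  refine integral_congr_ae (Eventually.of_forall fun t => ?_)
  simp [lap]

theorem lap_iterate_convolution {φ : Euc m → ℝ} (hφ : ContDiff ℝ ∞ φ) (hc : HasCompactSupport φ)
    {G : Euc m → F} (hG : LocallyIntegrable G) (n : ℕ) :
    lap^[n] (φ ⋆[ContinuousLinearMap.lsmul ℝ ℝ] G) =
      (lap^[n] φ) ⋆[ContinuousLinearMap.lsmul ℝ ℝ] G := by
  induction n generalizing φ with
  | zero => rfl
  | succ n ih =>
    rw [Function.iterate_succ_apply, lap_convolution hφ hc hG, ih (contDiff_lap hφ)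
      (hc.mono' (subset_closure.trans (tsupport_lap_subset φ)))]
    rfl

/-! ### Test functions and integration by parts -/

theorem continuous_smul_of_tsupport_subset {Ω : Set (Euc m)} (hΩ : IsOpen Ω) {φ : Euc m → ℝ}
    (hφ : Continuous φ) (hs : tsupport φ ⊆ Ω) {c : Euc m → F} (hc : ContinuousOn c Ω) :
    Continuous fun x => φ x • c x := by
  refine continuous_of_tsupport fun x hx => ?_
  have hx' : x ∈ Ω := hs (closure_mono (Function.support_smul_subset_left φ c) hx)
  exact hφ.continuousAt.smul (hc.continuousAt (hΩ.mem_nhds hx'))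

theorem integrable_smul_of_tsupport_subset {Ω : Set (Euc m)} (hΩ : IsOpen Ω) {φ : Euc m → ℝ}
    (hφ : Continuous φ) (hcs : HasCompactSupport φ) (hs : tsupport φ ⊆ Ω) {c : Euc m → F}
    (hc : ContinuousOn c Ω) : Integrable fun x => φ x • c x :=
  (continuous_smul_of_tsupport_subset hΩ hφ hs hc).integrable_of_hasCompactSupport hcs.smul_right

theorem continuousOn_coordDeriv {Ω : Set (Euc m)} (hΩ : IsOpen Ω) {c : Euc m → F}
    (hc : ContDiffOn ℝ 1 c Ω) (i : Fin m) : ContinuousOn (coordDeriv i c) Ω := by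
  refine ((hc.continuousOn_fderiv_of_isOpen hΩ le_rfl).clm_apply
    (continuousOn_const (c := stdVec i))).congr fun x hx => ?_
  exact coordDeriv_eq_fderiv ((hc.differentiableOn (by simp)).differentiableAt (hΩ.mem_nhds hx)) i

/-- Integration by parts against a test function supported in `Ω`; nothing is assumed about `c`
outside `Ω`. -/
theorem integral_smul_coordDeriv {Ω : Set (Euc m)} (hΩ : IsOpen Ω) {φ : Euc m → ℝ}
    (hφ : ContDiff ℝ ∞ φ) (hcs : HasCompactSupport φ) (hs : tsupport φ ⊆ Ω) {c : Euc m → F}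
    (hc : ContDiffOn ℝ 1 c Ω) (i : Fin m) :
    ∫ x, φ x • coordDeriv i c x = -∫ x, coordDeriv i φ x • c x := by
  refine integral_bilinear_hasLineDerivAt_right_eq_neg_left_of_integrable (v := stdVec i)
    (B := ContinuousLinearMap.lsmul ℝ ℝ) (f := φ) (g := c) ?_ ?_ ?_ ?_ ?_
  · exact integrable_smul_of_tsupport_subset hΩ (contDiff_coordDeriv hφ i).continuous
      (hasCompactSupport_coordDeriv hcs i) ((tsupport_coordDeriv_subset φ i).trans hs)
      hc.continuousOn
  · exact integrable_smul_of_tsupport_subset hΩ hφ.continuous hcs hs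
      (continuousOn_coordDeriv hΩ hc i)
  · exact integrable_smul_of_tsupport_subset hΩ hφ.continuous hcs hs hc.continuousOn
  · intro x _
    exact (hφ.differentiable (by simp) x).lineDifferentiableAt.hasLineDerivAt
  · intro x hx
    exact ((hc.differentiableOn (by simp)).differentiableAt
      (hΩ.mem_nhds (hs hx))).lineDifferentiableAt.hasLineDerivAt

/-! ### Radial means of polyharmonic functions -/

/-- The profiles `h` of the radial kernels `z ↦ h (|z|²)` supported in the ball of radius `1/2`. -/
structure IsProfile (h : ℝ → ℝ) : Prop where
  contDiff : ContDiff ℝ ∞ h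
  eq_zero : ∀ s, 1 / 4 ≤ s → h s = 0

theorem IsProfile.exists_primitive {h : ℝ → ℝ} (hh : IsProfile h) :
    ∃ H, IsProfile H ∧ ∀ s, HasDerivAt H (h s) s := by
  have hd : ∀ s, HasDerivAt (fun s => ∫ t in (1 / 4 : ℝ)..s, h t) (h s) s := fun s =>
    (hh.contDiff.continuous.integral_hasStrictDerivAt _ s).hasDerivAt
  refine ⟨fun s => ∫ t in (1 / 4 : ℝ)..s, h t, ⟨?_, fun s hs => ?_⟩, hd⟩
  · refine contDiff_infty_iff_deriv.2 ⟨fun s => (hd s).differentiableAt, ?_⟩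
    rw [funext fun s => (hd s).deriv]
    exact hh.contDiff
  · refine (intervalIntegral.integral_congr (g := fun _ => (0 : ℝ)) fun t ht => ?_).trans (by simp)
    rw [uIcc_of_le hs] at ht
    exact hh.eq_zero t ht.1

theorem IsProfile.contDiff_radial {h : ℝ → ℝ} (hh : IsProfile h) :
    ContDiff ℝ ∞ fun z : Euc m => h (‖z‖ ^ 2) :=
  hh.contDiff.comp (contDiff_norm_sq ℝ)

theorem IsProfile.norm_lt {h : ℝ → ℝ} (hh : IsProfile h) {z : Euc m} (hz : h (‖z‖ ^ 2) ≠ 0) :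
    ‖z‖ < 1 / 2 := by
  by_contra hlt
  exact hz (hh.eq_zero _ (by nlinarith))

theorem IsProfile.tsupport_subset {h : ℝ → ℝ} (hh : IsProfile h) :
    tsupport (fun z : Euc m => h (‖z‖ ^ 2)) ⊆ closedBall 0 (1 / 2) :=
  closure_minimal (fun _ hz => mem_closedBall_zero_iff.2 (hh.norm_lt hz).le) isClosed_closedBall

theorem IsProfile.hasCompactSupport {h : ℝ → ℝ} (hh : IsProfile h) :
    HasCompactSupport (fun z : Euc m => h (‖z‖ ^ 2)) :=
  HasCompactSupport.of_support_subset_isCompact (isCompact_closedBall 0 (1 / 2))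
    (subset_closure.trans hh.tsupport_subset)

theorem coordDeriv_radial {h H : ℝ → ℝ} (hH : ∀ s, HasDerivAt H (h s) s) (i : Fin m)
    (z : Euc m) : coordDeriv i (fun z : Euc m => H (‖z‖ ^ 2)) z = 2 * z i * h (‖z‖ ^ 2) := by
  have h2 := (hH (‖z‖ ^ 2)).comp_hasFDerivAt z (hasStrictFDerivAt_norm_sq z).hasFDerivAt
  rw [Function.comp_def] at h2
  rw [coordDeriv_eq_fderiv h2.differentiableAt, h2.fderiv]
  simp [EuclideanSpace.inner_single_right]
  ring

/-- The radial derivative of a radial mean is a radial mean of the Laplacian: `2 z_i h (|z|²)` is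
the derivative `∂_i` of `H (|z|²)`, which allows an integration by parts. -/
theorem hasDerivAt_integral_radial [CompleteSpace F] {h H : ℝ → ℝ} (hh : IsProfile h)
    (hH : IsProfile H)
    (hd : ∀ s, HasDerivAt H (h s) s) {v : Euc m → F} (hv : ContDiff ℝ ∞ v) (y : Euc m) (r : ℝ) :
    HasDerivAt (fun r : ℝ => ∫ z, h (‖z‖ ^ 2) • v (y - r • z))
      ((-(r / 2)) • ∫ z, H (‖z‖ ^ 2) • lap v (y - r • z)) r := by
  have hv1 : Differentiable ℝ v := hv.differentiable (by simp)
  have hcf : Continuous (fderiv ℝ v) := hv.continuous_fderiv (by simp)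
  have hch : Continuous h := hh.contDiff.continuous
  have hcv := hv.continuous
  let Φ : ℝ × Euc m → F := fun p => h (‖p.2‖ ^ 2) • (-(fderiv ℝ v (y - p.1 • p.2) p.2))
  have hΦ : Continuous Φ := by
    have : Continuous fun p : ℝ × Euc m => fderiv ℝ v (y - p.1 • p.2) p.2 :=
      (hcf.comp (by fun_prop)).clm_apply continuous_snd
    exact (by fun_prop : Continuous fun p : ℝ × Euc m => h (‖p.2‖ ^ 2)).smul this.neg
  obtain ⟨C, hC⟩ := ((isCompact_closedBall r 1).prod
    (isCompact_closedBall (0 : Euc m) (1 / 2))).exists_bound_of_continuousOn hΦ.continuousOn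
  -- differentiation under the integral sign; `Φ (r, z)` is the derivative of the integrand in `r`
  have hder : HasDerivAt (fun r : ℝ => ∫ z, h (‖z‖ ^ 2) • v (y - r • z))
      (∫ z, Φ (r, z)) r := by
    refine (hasDerivAt_integral_of_dominated_loc_of_deriv_le (μ := volume)
      (F := fun r z => h (‖z‖ ^ 2) • v (y - r • z))
      (F' := fun r z => Φ (r, z)) (bound := indicator (closedBall (0 : Euc m) (1 / 2)) fun _ => C)
      (closedBall_mem_nhds r one_pos) ?_ ?_ ?_ ?_ ?_ ?_).2
    · exact Eventually.of_forall fun r => Continuous.aestronglyMeasurable (by fun_prop)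
    · exact Continuous.integrable_of_hasCompactSupport (by fun_prop)
        (hh.hasCompactSupport.smul_right)
    · exact (hΦ.comp (by fun_prop)).aestronglyMeasurable
    · refine Eventually.of_forall fun z s hs => ?_
      by_cases hz : h (‖z‖ ^ 2) = 0
      · simp only [Φ, hz, zero_smul, norm_zero]
        refine indicator_nonneg (fun z hz => ?_) z
        exact (norm_nonneg _).trans (hC (s, z) ⟨hs, hz⟩)
      · have hz' : z ∈ closedBall (0 : Euc m) (1 / 2) :=
          mem_closedBall_zero_iff.2 (hh.norm_lt hz).le
        rw [indicator_of_mem hz']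
        exact hC (s, z) ⟨hs, hz'⟩
    · exact (integrable_indicator_iff isClosed_closedBall.measurableSet).2
        (integrableOn_const (isCompact_closedBall _ _).measure_lt_top.ne)
    · refine Eventually.of_forall fun z s _ => ?_
      have h1 : HasDerivAt (fun s : ℝ => y - s • z) (-z) s := by
        simpa using ((hasDerivAt_id s).smul_const z).const_sub y
      have h2 := (hv1 (y - s • z)).hasFDerivAt.comp_hasDerivAt s h1
      rw [map_neg] at h2
      exact h2.const_smul (h (‖z‖ ^ 2))
  convert hder using 1
  -- the coordinate form of `Φ`, in which `z_i h (|z|²)` is replaced by `∂_i` of the primitive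
  have hsum : ∀ z : Euc m, Φ (r, z) = (-(1 / 2 : ℝ)) • ∑ i,
      (coordDeriv i (fun z : Euc m => H (‖z‖ ^ 2)) z • coordDeriv i v (y - r • z)) := by
    intro z
    have hz : z = ∑ i, z i • stdVec i := by
      ext j
      simp [Finset.sum_apply, Pi.single_apply]
    have : fderiv ℝ v (y - r • z) z = ∑ i, z i • coordDeriv i v (y - r • z) := by
      conv_lhs => rw [hz]
      rw [map_sum]
      refine Finset.sum_congr rfl fun i _ => ?_
      rw [map_smul, coordDeriv_eq_fderiv (hv1 _), ← hz]
    simp only [Φ, this, smul_neg, Finset.smul_sum, ← Finset.sum_neg_distrib]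
    refine Finset.sum_congr rfl fun i _ => ?_
    rw [coordDeriv_radial hd, smul_smul, smul_smul, ← neg_smul]
    congr 1
    ring
  have hw : ∀ i, ContDiff ℝ ∞ fun z => coordDeriv i v (y - r • z) := fun i =>
    (contDiff_coordDeriv hv i).comp (contDiff_const.sub (contDiff_id.const_smul r))
  have hdw : ∀ i z, coordDeriv i (fun z => coordDeriv i v (y - r • z)) z =
      (-r) • coordDeriv i (coordDeriv i v) (y - r • z) := by
    intro i z
    rw [coordDeriv_comp_smul r (fun w => coordDeriv i v (y - w)), coordDeriv_comp_sub]
    simp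
  simp_rw [hsum]
  have hint : ∀ i, Integrable fun z =>
      coordDeriv i (fun z : Euc m => H (‖z‖ ^ 2)) z • coordDeriv i v (y - r • z) := fun i =>
    integrable_smul_of_tsupport_subset isOpen_univ
      (contDiff_coordDeriv hH.contDiff_radial i).continuous
      (hasCompactSupport_coordDeriv hH.hasCompactSupport i) (subset_univ _)
      (hw i).continuous.continuousOn
  have hint2 : ∀ i, Integrable fun z =>
      H (‖z‖ ^ 2) • coordDeriv i (coordDeriv i v) (y - r • z) := fun i =>
    integrable_smul_of_tsupport_subset isOpen_univ
      (hH.contDiff_radial).continuous hH.hasCompactSupport (subset_univ _)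
      ((contDiff_coordDeriv (contDiff_coordDeriv hv i) i).continuous.comp
        (by fun_prop : Continuous fun z : Euc m => y - r • z)).continuousOn
  rw [integral_smul, integral_finsetSum _ fun i _ => hint i]
  simp only [lap, Finset.smul_sum]
  rw [integral_finsetSum _ fun i _ => hint2 i, Finset.smul_sum]
  refine Finset.sum_congr rfl fun i _ => ?_
  have hibp := integral_smul_coordDeriv isOpen_univ hH.contDiff_radial hH.hasCompactSupport
    (subset_univ _) ((hw i).of_le (m := 1) (by norm_cast)).contDiffOn i
  simp_rw [hdw, smul_comm _ (-r)] at hibp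
  rw [integral_smul, neg_smul, neg_inj] at hibp
  rw [← hibp, smul_smul]
  congr 1
  ring

/-- Pizzetti's formula: if `Δ^N v = 0` near `y`, the radial means of `v` about `y` are polynomials
of degree less than `N` in the square of the radius. -/
theorem integral_radial_eq_polynomial [CompleteSpace F] (N : ℕ) {h : ℝ → ℝ} (hh : IsProfile h)
    {v : Euc m → F} (hv : ContDiff ℝ ∞ v) {y : Euc m} {ρ : ℝ}
    (hρ : 0 < ρ) (hN : ∀ x ∈ ball y ρ, lap^[N] v x = 0) :
    ∃ a : ℕ → F, ∀ r ∈ Icc 0 (2 * ρ), ∫ z, h (‖z‖ ^ 2) • v (y - r • z) =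
      ∑ j ∈ Finset.range N, r ^ (2 * j) • a j := by
  induction N generalizing h v with
  | zero =>
    refine ⟨0, fun r hr => ?_⟩
    rw [Finset.range_zero, Finset.sum_empty]
    refine integral_eq_zero_of_ae (Eventually.of_forall fun z => ?_)
    by_cases hz : h (‖z‖ ^ 2) = 0
    · simp [hz]
    · have hz2 := hh.norm_lt hz
      have := hN (y - r • z) (by
        rw [mem_ball_iff_norm, sub_sub_cancel_left, norm_neg, norm_smul, Real.norm_of_nonneg hr.1]
        nlinarith [hr.1, hr.2, norm_nonneg z])
      simp only [Function.iterate_zero, id] at this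
      simp [this]
  | succ N ih =>
    obtain ⟨H, hH, hd⟩ := hh.exists_primitive
    obtain ⟨a, ha⟩ := ih hH (contDiff_lap hv) hN
    -- `P` is the antiderivative, vanishing at `0`, of the polynomial that the inductive
    -- hypothesis provides for the derivative of the radial mean
    let P : ℝ → F := fun r => ∑ j ∈ Finset.range N,
      (r ^ (2 * (j + 1))) • ((-(1 / (4 * ((j : ℝ) + 1)))) • a j)
    have hP : ∀ r, HasDerivAt P ((-(r / 2)) • ∑ j ∈ Finset.range N, r ^ (2 * j) • a j) r := by
      intro r
      rw [Finset.smul_sum]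
      refine HasDerivAt.fun_sum fun j _ => ?_
      convert (hasDerivAt_pow (2 * (j + 1)) r).smul_const ((-(1 / (4 * ((j : ℝ) + 1)))) • a j)
        using 1
      rw [smul_smul, smul_smul]
      congr 1
      have : (j : ℝ) + 1 ≠ 0 := by positivity
      rw [show 2 * (j + 1) - 1 = 2 * j + 1 by omega]
      push_cast
      field_simp
      ring
    have hconst : ∀ r ∈ Icc 0 (2 * ρ), (∫ z, h (‖z‖ ^ 2) • v (y - r • z)) - P r =
        (∫ z, h (‖z‖ ^ 2) • v (y - (0 : ℝ) • z)) - P 0 := by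
      have hD := fun r => (hasDerivAt_integral_radial hh hH hd hv y r).sub (hP r)
      refine constant_of_has_deriv_right_zero (fun r _ => (hD r).continuousAt.continuousWithinAt)
        fun r hr => ?_
      have := hD r
      rw [ha r ⟨hr.1, hr.2.le⟩, sub_self] at this
      exact this.hasDerivWithinAt
    refine ⟨fun j => if j = 0 then (∫ z, h (‖z‖ ^ 2) • v (y - (0 : ℝ) • z)) - P 0 else
      (-(1 / (4 * (((j - 1 : ℕ) : ℝ) + 1)))) • a (j - 1), fun r hr => ?_⟩
    rw [sub_eq_iff_eq_add.1 (hconst r hr), Finset.sum_range_succ']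
    simp [P, add_comm]

/-! ### Weakly polyharmonic functions and their reproducing kernel -/

/-- The space of test functions on `Ω`. -/
def testFun (Ω : Set (Euc m)) : Submodule ℝ (Euc m → ℝ) where
  carrier := {φ | ContDiff ℝ ∞ φ ∧ HasCompactSupport φ ∧ tsupport φ ⊆ Ω}
  add_mem' := fun ⟨h1, h2, h3⟩ ⟨k1, k2, k3⟩ =>
    ⟨h1.add k1, h2.add k2, (tsupport_add _ _).trans (union_subset h3 k3)⟩
  zero_mem' := ⟨contDiff_const, HasCompactSupport.zero, by
    rw [tsupport_eq_empty_iff.2 rfl]; exact empty_subset _⟩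
  smul_mem' := fun c _ ⟨h1, h2, h3⟩ =>
    ⟨contDiff_const.smul h1, h2.smul_left,
      (closure_mono (Function.support_const_smul_subset c _)).trans h3⟩

theorem coordDeriv_mem_testFun {Ω : Set (Euc m)} {φ : Euc m → ℝ} (h : φ ∈ testFun Ω)
    (i : Fin m) : coordDeriv i φ ∈ testFun Ω :=
  ⟨contDiff_coordDeriv h.1 i, hasCompactSupport_coordDeriv h.2.1 i,
    (tsupport_coordDeriv_subset φ i).trans h.2.2⟩

theorem lap_mem_testFun {Ω : Set (Euc m)} {φ : Euc m → ℝ} (h : φ ∈ testFun Ω) :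
    lap φ ∈ testFun Ω :=
  ⟨contDiff_lap h.1, h.2.1.mono' (subset_closure.trans (tsupport_lap_subset φ)),
    (tsupport_lap_subset φ).trans h.2.2⟩

theorem integrable_testFun_smul {Ω : Set (Euc m)} (hΩ : IsOpen Ω) {φ : Euc m → ℝ}
    (h : φ ∈ testFun Ω) {c : Euc m → F} (hc : ContinuousOn c Ω) :
    Integrable fun x => φ x • c x :=
  integrable_smul_of_tsupport_subset hΩ h.1.continuous h.2.1 h.2.2 hc

/-- A continuous function on `Ω` that solves `Δ^N g = 0` in the sense of distributions. -/
structure IsWeaklyPolyharmonic (N : ℕ) (Ω : Set (Euc m)) (g : Euc m → F) : Prop where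
  continuousOn : ContinuousOn g Ω
  integral_eq_zero : ∀ φ ∈ testFun Ω, ∫ x, (lap^[N] φ) x • g x = 0

/-- Weights that extrapolate an even polynomial of degree less than `2 N` to the origin. -/
theorem exists_weights (N : ℕ) : ∃ w t : ℕ → ℝ, (∀ i < N, 0 < t i ∧ t i ≤ 1) ∧
    ∀ j < N, ∑ i ∈ Finset.range N, w i * t i ^ (2 * j) = if j = 0 then 1 else 0 := by
  -- the weights are the values at `0` of the Lagrange basis for the nodes `t_i²`
  let t : ℕ → ℝ := fun i => ((i : ℝ) + 1) / N
  have ht : ∀ i < N, 0 < t i ∧ t i ≤ 1 := by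
    intro i hi
    have hN : (0 : ℝ) < N := by exact_mod_cast (Nat.zero_le i).trans_lt hi
    refine ⟨by positivity, ?_⟩
    rw [div_le_one hN]
    exact_mod_cast hi
  have hinj : Set.InjOn (fun i => t i ^ 2) (Finset.range N : Set ℕ) := by
    intro i hi j hj hij
    have hi' := Finset.mem_range.1 hi
    have hj' := Finset.mem_range.1 hj
    have hN : (0 : ℝ) < N := by exact_mod_cast (Nat.zero_le i).trans_lt hi'
    have h := (pow_left_inj₀ (ht i hi').1.le (ht j hj').1.le two_ne_zero).1 hij
    simp only [t] at h
    field_simp at h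
    exact_mod_cast add_right_cancel h
  refine ⟨fun i => (Lagrange.basis (Finset.range N) (fun i => t i ^ 2) i).eval 0, t, ht,
    fun j hj => ?_⟩
  have h := Lagrange.eq_interpolate (f := (Polynomial.X : Polynomial ℝ) ^ j) hinj (by
    rw [Polynomial.degree_X_pow, Finset.card_range]; exact_mod_cast hj)
  have h2 := congrArg (Polynomial.eval 0) h
  simp only [Polynomial.eval_pow, Polynomial.eval_X, Lagrange.interpolate_apply,
    Polynomial.eval_finsetSum, Polynomial.eval_mul, Polynomial.eval_C, zero_pow_eq] at h2
  rw [h2]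
  exact Finset.sum_congr rfl fun i _ => by rw [pow_mul, mul_comm]

/-- The mean value property of smooth polyharmonic functions: a fixed combination of radial means
over `N` radii gives the value at the centre. -/
theorem sum_integral_radial_eq [CompleteSpace F] {N : ℕ} {w t : ℕ → ℝ}
    (ht : ∀ i < N, 0 < t i ∧ t i ≤ 1)
    (hw : ∀ j < N, ∑ i ∈ Finset.range N, w i * t i ^ (2 * j) = if j = 0 then 1 else 0)
    {h : ℝ → ℝ} (hh : IsProfile h) {v : Euc m → F} (hv : ContDiff ℝ ∞ v) {y : Euc m} {R : ℝ}
    (hR : 0 < R) (hv0 : ∀ x ∈ ball y (R / 2), lap^[N] v x = 0) :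
    ∑ i ∈ Finset.range N, w i • ∫ z, h (‖z‖ ^ 2) • v (y - (R * t i) • z) =
      (∫ z : Euc m, h (‖z‖ ^ 2)) • v y := by
  obtain ⟨a, ha⟩ := integral_radial_eq_polynomial N hh hv (half_pos hR) hv0
  have h0 := ha 0 ⟨le_rfl, by linarith⟩
  simp only [zero_smul, sub_zero] at h0
  rw [integral_smul_const] at h0
  rw [h0]
  have h1 : ∀ i ∈ Finset.range N, w i • ∫ z, h (‖z‖ ^ 2) • v (y - (R * t i) • z) =
      ∑ j ∈ Finset.range N, (w i * t i ^ (2 * j)) • R ^ (2 * j) • a j := by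
    intro i hi
    obtain ⟨h1, h2⟩ := ht i (Finset.mem_range.1 hi)
    rw [ha (R * t i) ⟨by positivity, by nlinarith⟩, Finset.smul_sum]
    refine Finset.sum_congr rfl fun j _ => ?_
    rw [smul_smul, smul_smul, mul_pow]
    congr 1
    ring
  rw [Finset.sum_congr rfl h1, Finset.sum_comm]
  refine Finset.sum_congr rfl fun j hj => ?_
  rw [← Finset.sum_smul, hw j (Finset.mem_range.1 hj)]
  by_cases hj0 : j = 0
  · simp [hj0]
  · simp [hj0]

/-- Mollifications of a weakly polyharmonic function are polyharmonic: `Δ^N φ (x - ·)` is `Δ^N` of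
the test function `φ (x - ·)`. -/
theorem lap_iterate_convolution_eq_zero {N : ℕ} {Ω : Set (Euc m)} {g : Euc m → F}
    (hg : IsWeaklyPolyharmonic N Ω g) {y : Euc m} {R : ℝ} (hy : closedBall y R ⊆ Ω)
    {φ : Euc m → ℝ} (hφ : ContDiff ℝ ∞ φ) (hs : tsupport φ ⊆ closedBall 0 (R / 4))
    {x : Euc m} (hx : x ∈ ball y (R / 2)) :
    ((lap^[N] φ) ⋆[ContinuousLinearMap.lsmul ℝ ℝ] ((closedBall y R).indicator g)) x = 0 := by
  have hsub : closedBall x (R / 4) ⊆ closedBall y R := by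
    refine closedBall_subset_closedBall' ?_
    have := mem_ball.1 hx
    have := dist_nonneg (x := x) (y := y)
    linarith
  have hts : tsupport (fun t => φ (x - t)) ⊆ closedBall x (R / 4) := by
    refine closure_minimal (fun t ht => ?_) isClosed_closedBall
    have := hs (subset_closure (show x - t ∈ Function.support φ from ht))
    rwa [mem_closedBall_zero_iff, ← dist_eq_norm, dist_comm] at this
  have hmem : (fun t => φ (x - t)) ∈ testFun Ω :=
    ⟨hφ.comp (contDiff_const.sub contDiff_id),
      HasCompactSupport.of_support_subset_isCompact (isCompact_closedBall x (R / 4))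
        (subset_closure.trans hts), hts.trans (hsub.trans hy)⟩
  rw [convolution_eq_swap, ← hg.integral_eq_zero _ hmem, lap_iterate_comp_sub]
  refine integral_congr_ae (Eventually.of_forall fun t => ?_)
  by_cases ht : t ∈ closedBall y R
  · simp [indicator_of_mem ht]
  · have : (lap^[N] φ) (x - t) = 0 := by
      refine image_eq_zero_of_notMem_tsupport fun h => ht (hsub ?_)
      have := hs (tsupport_lap_iterate_subset φ N h)
      rwa [mem_closedBall_zero_iff, ← dist_eq_norm, dist_comm] at this
    simp [this]

/-- Mollification extends the mean value property to weakly polyharmonic functions. -/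
theorem IsWeaklyPolyharmonic.sum_integral_radial_eq [CompleteSpace F] {N : ℕ}
    {w t : ℕ → ℝ} (ht : ∀ i < N, 0 < t i ∧ t i ≤ 1)
    (hw : ∀ j < N, ∑ i ∈ Finset.range N, w i * t i ^ (2 * j) = if j = 0 then 1 else 0)
    {h : ℝ → ℝ} (hh : IsProfile h) {Ω : Set (Euc m)} {g : Euc m → F}
    (hg : IsWeaklyPolyharmonic N Ω g) {y : Euc m} {R : ℝ} (hR : 0 < R)
    (hy : closedBall y R ⊆ Ω) :
    ∑ i ∈ Finset.range N, w i • ∫ z, h (‖z‖ ^ 2) • g (y - (R * t i) • z) =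
      (∫ z : Euc m, h (‖z‖ ^ 2)) • g y := by
  have hgc : ContinuousOn g (closedBall y R) := hg.continuousOn.mono hy
  set G := (closedBall y R).indicator g with hG
  have hGint : Integrable G := (integrable_indicator_iff isClosed_closedBall.measurableSet).2
    (hgc.integrableOn_compact (isCompact_closedBall _ _))
  obtain ⟨C, hC⟩ := (isCompact_closedBall y R).exists_bound_of_continuousOn hgc
  have hGC : ∀ x, ‖G x‖ ≤ C := by
    intro x
    by_cases hx : x ∈ closedBall y R
    · simpa [hG, indicator_of_mem hx] using hC x hx
    · simpa [hG, indicator_of_notMem hx] using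
        (norm_nonneg _).trans (hC y (mem_closedBall_self hR.le))
  have hpos : ∀ n : ℕ, 0 < R / (8 * ((n : ℝ) + 1)) := fun n => by positivity
  -- the mollifiers have radius at most `R / 4`, so that the mollified functions are polyharmonic
  -- on the ball of radius `R / 2`, which contains all points `y - (R t_i) z` with `h (|z|²) ≠ 0`
  let φ : ℕ → ContDiffBump (0 : Euc m) := fun n =>
    ⟨R / (8 * ((n : ℝ) + 1)), 2 * (R / (8 * ((n : ℝ) + 1))), hpos n, by linarith [hpos n]⟩
  have hφ0 : Tendsto (fun n => (φ n).rOut) atTop (𝓝 0) := by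
    have := (tendsto_one_div_add_atTop_nhds_zero_nat (𝕜 := ℝ)).const_mul (R / 4)
    rw [mul_zero] at this
    refine this.congr fun n => ?_
    simp only [φ]
    field_simp
    norm_num
  have hφR : ∀ n, (φ n).rOut ≤ R / 4 := by
    intro n
    have : R / (8 * ((n : ℝ) + 1)) ≤ R / 8 := by
      gcongr
      linarith [n.cast_nonneg (α := ℝ)]
    simp only [φ]
    linarith
  let v : ℕ → Euc m → F := fun n =>
    ((φ n).normed volume) ⋆[ContinuousLinearMap.lsmul ℝ ℝ] G
  have hφs : ∀ n, ContDiff ℝ ∞ ((φ n).normed volume) := fun n => (φ n).contDiff_normed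
  have hφc : ∀ n, HasCompactSupport ((φ n).normed volume) := fun n => (φ n).hasCompactSupport_normed
  have hv : ∀ n, ContDiff ℝ ∞ (v n) := fun n =>
    (hφc n).contDiff_convolution_left _ (hφs n) hGint.locallyIntegrable
  have hv0 : ∀ n, ∀ x ∈ ball y (R / 2), lap^[N] (v n) x = 0 := by
    intro n x hx
    rw [lap_iterate_convolution (hφs n) (hφc n) hGint.locallyIntegrable]
    refine lap_iterate_convolution_eq_zero hg hy (hφs n) ?_ hx
    rw [(φ n).tsupport_normed_eq]
    exact closedBall_subset_closedBall (hφR n)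
  have hvC : ∀ n x, ‖v n x‖ ≤ C := by
    intro n x
    have h1 : Integrable fun t => (φ n).normed volume t * C :=
      (φ n).integrable_normed.mul_const C
    have h2 : ‖v n x‖ ≤ ∫ t, (φ n).normed volume t * C := by
      refine norm_integral_le_of_norm_le h1 (Eventually.of_forall fun t => ?_)
      simp only [ContinuousLinearMap.lsmul_apply, norm_smul,
        Real.norm_of_nonneg ((φ n).nonneg_normed t)]
      exact mul_le_mul_of_nonneg_left (hGC _) ((φ n).nonneg_normed t)
    rwa [integral_mul_const, (φ n).integral_normed, one_mul] at h2
  have hvg : ∀ x ∈ ball y R, Tendsto (fun n => v n x) atTop (𝓝 (g x)) := by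
    intro x hx
    refine ContDiffBump.convolution_tendsto_right (g := fun _ => G) (k := fun _ => x) hφ0
      (Eventually.of_forall fun _ => hGint.aestronglyMeasurable) ?_ tendsto_const_nhds
    have hGx : Tendsto G (𝓝 x) (𝓝 (g x)) := by
      have h1 : ContinuousAt g x := hgc.continuousAt (closedBall_mem_nhds_of_mem hx)
      refine h1.congr' ?_
      filter_upwards [closedBall_mem_nhds_of_mem hx] with z hz
      rw [hG, indicator_of_mem hz]
    exact hGx.comp tendsto_snd
  have hlim : ∀ i ∈ Finset.range N,
      Tendsto (fun n => w i • ∫ z, h (‖z‖ ^ 2) • v n (y - (R * t i) • z)) atTop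
        (𝓝 (w i • ∫ z, h (‖z‖ ^ 2) • g (y - (R * t i) • z))) := by
    intro i hi
    obtain ⟨ht0, ht1⟩ := ht i (Finset.mem_range.1 hi)
    refine Tendsto.const_smul ?_ (w i)
    have hhi : Integrable fun z : Euc m => h (‖z‖ ^ 2) :=
      hh.contDiff_radial.continuous.integrable_of_hasCompactSupport hh.hasCompactSupport
    refine tendsto_integral_of_dominated_convergence (fun z => ‖h (‖z‖ ^ 2)‖ * C) ?_
      (hhi.norm.mul_const C) ?_ ?_
    · intro n
      exact (hh.contDiff_radial.continuous.smul ((hv n).continuous.comp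
        (by fun_prop : Continuous fun z : Euc m => y - (R * t i) • z))).aestronglyMeasurable
    · intro n
      refine Eventually.of_forall fun z => ?_
      rw [norm_smul]
      exact mul_le_mul_of_nonneg_left (hvC n _) (norm_nonneg _)
    · refine Eventually.of_forall fun z => ?_
      by_cases hz : h (‖z‖ ^ 2) = 0
      · simp [hz]
      · refine (hvg _ ?_).const_smul _
        have hz2 := hh.norm_lt hz
        rw [mem_ball_iff_norm, sub_sub_cancel_left, norm_neg, norm_smul,
          Real.norm_of_nonneg (by positivity)]
        nlinarith [mul_pos hR ht0, norm_nonneg z]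
  refine tendsto_nhds_unique (tendsto_finsetSum _ hlim) ?_
  have heq : ∀ n, ∑ i ∈ Finset.range N, w i • ∫ z, h (‖z‖ ^ 2) • v n (y - (R * t i) • z) =
      (∫ z : Euc m, h (‖z‖ ^ 2)) • v n y := fun n =>
    RaritaSchwinger.sum_integral_radial_eq ht hw hh (hv n) hR (hv0 n)
  simp_rw [heq]
  exact (hvg y (mem_ball_self hR)).const_smul _

theorem exists_isProfile_integral_pos (m : ℕ) :
    ∃ h, IsProfile h ∧ 0 < ∫ z : Euc m, h (‖z‖ ^ 2) := by
  let h : ℝ → ℝ := fun s => Real.smoothTransition (1 - 4 * s)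
  have hh : IsProfile h :=
    ⟨Real.smoothTransition.contDiff.comp (contDiff_const.sub (contDiff_const.mul contDiff_id)),
      fun s hs => Real.smoothTransition.zero_of_nonpos (by linarith)⟩
  refine ⟨h, hh, ?_⟩
  refine hh.contDiff_radial.continuous.integral_pos_of_hasCompactSupport_nonneg_nonzero
    (x := 0) hh.hasCompactSupport (fun z => Real.smoothTransition.nonneg _) ?_
  simp [h, Real.smoothTransition.one_of_one_le]

/-- There is a smooth kernel supported in the unit ball that reproduces all weakly polyharmonic
functions of order `N`, on all balls. -/
theorem exists_reproducing_kernel (m : ℕ) (F : Type*) [NormedAddCommGroup F] [NormedSpace ℝ F]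
    [CompleteSpace F] (N : ℕ) :
    ∃ ψ : Euc m → ℝ, ContDiff ℝ ∞ ψ ∧ tsupport ψ ⊆ closedBall 0 (1 / 2) ∧
      ∀ (Ω : Set (Euc m)) (g : Euc m → F), IsOpen Ω → IsWeaklyPolyharmonic N Ω g →
        ∀ (y : Euc m) (R : ℝ), 0 < R → closedBall y R ⊆ Ω →
          g y = ∫ z, ψ z • g (y - R • z) := by
  obtain ⟨w, t, ht, hw⟩ := exists_weights N
  obtain ⟨h, hh, hpos⟩ := exists_isProfile_integral_pos m
  set c := ∫ z : Euc m, h (‖z‖ ^ 2)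
  -- the kernel combines the dilates by `t_i` of one radial bump function, of total mass `c`
  let K : ℕ → Euc m → ℝ := fun i z => h (‖(t i)⁻¹ • z‖ ^ 2)
  have hK : ∀ i, ContDiff ℝ ∞ (K i) := fun i =>
    (hh.contDiff_radial (m := m)).comp (contDiff_id.const_smul (t i)⁻¹)
  have hKs : ∀ i < N, ∀ z, K i z ≠ 0 → ‖z‖ ≤ 1 / 2 := by
    intro i hi z hz
    obtain ⟨h0, h1⟩ := ht i hi
    have := hh.norm_lt hz
    rw [norm_smul, norm_inv, Real.norm_of_nonneg h0.le, inv_mul_lt_iff₀ h0] at this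
    linarith
  refine ⟨fun z => ∑ i ∈ Finset.range N, (c⁻¹ * w i * (t i ^ m)⁻¹) * K i z, ?_, ?_, ?_⟩
  · exact ContDiff.sum fun i _ => contDiff_const.mul (hK i)
  · refine closure_minimal (fun z hz => ?_) isClosed_closedBall
    obtain ⟨i, hi, hne⟩ := Finset.exists_ne_zero_of_sum_ne_zero hz
    exact mem_closedBall_zero_iff.2 (hKs i (Finset.mem_range.1 hi) z (right_ne_zero_of_mul hne))
  · intro Ω g hΩ hg y R hR hy
    have hm := hg.sum_integral_radial_eq ht hw hh hR hy
    have hgG : ∀ i ∈ Finset.range N, Integrable fun z =>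
        ((c⁻¹ * w i * (t i ^ m)⁻¹) * K i z) • g (y - R • z) := by
      intro i hi
      have hKt : tsupport (K i) ⊆ closedBall 0 (1 / 2) := closure_minimal
        (fun z hz => mem_closedBall_zero_iff.2 (hKs i (Finset.mem_range.1 hi) z hz))
        isClosed_closedBall
      have hcz : Continuous fun z : Euc m => y - R • z := by fun_prop
      simp_rw [mul_smul _ (K i _)]
      refine (integrable_smul_of_tsupport_subset (hΩ.preimage hcz) (hK i).continuous
        (HasCompactSupport.of_support_subset_isCompact (isCompact_closedBall 0 (1 / 2))
          (subset_closure.trans hKt)) (hKt.trans fun z hz => hy ?_)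
        (hg.continuousOn.comp hcz.continuousOn fun z hz => hz)).smul (c⁻¹ * w i * (t i ^ m)⁻¹)
      rw [mem_closedBall_zero_iff] at hz
      rw [mem_closedBall_iff_norm, sub_sub_cancel_left, norm_neg, norm_smul,
        Real.norm_of_nonneg hR.le]
      nlinarith
    simp_rw [Finset.sum_smul]
    rw [integral_finsetSum _ hgG]
    have hi : ∀ i ∈ Finset.range N, ∫ z, ((c⁻¹ * w i * (t i ^ m)⁻¹) * K i z) • g (y - R • z) =
        c⁻¹ • w i • ∫ z, h (‖z‖ ^ 2) • g (y - (R * t i) • z) := by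
      intro i hi
      have h0 := (ht i (Finset.mem_range.1 hi)).1
      have hcv := Measure.integral_comp_inv_smul (volume : Measure (Euc m))
        (fun z => h (‖z‖ ^ 2) • g (y - (R * t i) • z)) (t i)
      simp_rw [mul_smul, integral_smul]
      congr 2
      rw [inv_smul_eq_iff₀ (by positivity)]
      convert hcv using 1
      · refine integral_congr_ae (Eventually.of_forall fun z => ?_)
        simp only [K]
        rw [smul_smul, mul_assoc, mul_inv_cancel₀ h0.ne', mul_one]
      · rw [finrank_euclideanSpace_fin, abs_of_pos (by positivity)]
        simp_rw [mul_smul]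
    rw [Finset.sum_congr rfl hi, ← Finset.smul_sum, hm, smul_smul, inv_mul_cancel₀ hpos.ne',
      one_smul]

/-! ### Regularity and Cauchy estimates for weakly polyharmonic functions -/

/-- Near `y` the reproducing formula is a convolution, on balls of the fixed radius `ρ`. The values
of `g` outside the ball of radius `2 ρ` do not enter, so `g` may be cut off there. -/
theorem eventuallyEq_convolution_of_reproducing {ψ : Euc m → ℝ}
    (hs : tsupport ψ ⊆ closedBall 0 (1 / 2)) {Ω : Set (Euc m)} {g : Euc m → F}
    (hrep : ∀ (y : Euc m) (R : ℝ), 0 < R → closedBall y R ⊆ Ω →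
      g y = ∫ z, ψ z • g (y - R • z))
    {y : Euc m} {ρ : ℝ} (hρ : 0 < ρ) (hy : closedBall y (2 * ρ) ⊆ Ω) :
    g =ᶠ[𝓝 y] ((fun z => (ρ ^ m)⁻¹ * ψ (ρ⁻¹ • z)) ⋆[ContinuousLinearMap.lsmul ℝ ℝ]
      (ball y (2 * ρ)).indicator g) := by
  filter_upwards [ball_mem_nhds y hρ] with x hx
  have hsub : closedBall x ρ ⊆ closedBall y (2 * ρ) := by
    refine closedBall_subset_closedBall' ?_
    linarith [mem_ball.1 hx]
  rw [hrep x ρ hρ (hsub.trans hy)]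
  have hcv := Measure.integral_comp_inv_smul (volume : Measure (Euc m))
    (fun z => ψ z • g (x - ρ • z)) ρ
  rw [finrank_euclideanSpace_fin, abs_of_pos (by positivity)] at hcv
  rw [← inv_smul_smul₀ (pow_pos hρ m).ne' (∫ z, ψ z • g (x - ρ • z)), ← hcv, ← integral_smul]
  unfold convolution
  refine integral_congr_ae (Eventually.of_forall fun z => ?_)
  simp only [ContinuousLinearMap.lsmul_apply]
  by_cases hz : ψ (ρ⁻¹ • z) = 0
  · simp [hz]
  · have hz2 := hs (subset_closure (show ρ⁻¹ • z ∈ Function.support ψ from hz))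
    rw [mem_closedBall_zero_iff, norm_smul, norm_inv, Real.norm_of_nonneg hρ.le,
      inv_mul_le_iff₀ hρ] at hz2
    rw [indicator_of_mem, smul_smul, smul_smul, mul_inv_cancel₀ hρ.ne', one_smul]
    rw [mem_ball, dist_eq_norm] at hx ⊢
    calc ‖x - z - y‖ = ‖(x - y) - z‖ := by congr 1; abel
      _ ≤ ‖x - y‖ + ‖z‖ := norm_sub_le _ _
      _ < 2 * ρ := by linarith

theorem iterCoordDeriv_const_mul_comp_smul (ψ : Euc m → ℝ) (a c : ℝ) (α : Fin m → ℕ)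
    (l : List (Fin m)) : iterCoordDeriv α l (fun z => a * ψ (c • z)) =
      fun z => c ^ (l.map α).sum * (a * iterCoordDeriv α l ψ (c • z)) := by
  have := iterCoordDeriv_rel (m := m) (F := ℝ) (F' := ℝ) (n := 0)
    (R := fun n f ψ => f = (c ^ n * a) • fun z => ψ (c • z))
    (fun n f ψ i h => by
      subst h
      rw [coordDeriv_const_smul, coordDeriv_comp_smul, smul_smul]
      congr 1
      ring) α l (g := fun z => a * ψ (c • z)) (g' := ψ) (by funext z; simp)
  rw [this]
  funext z
  simp [mul_assoc]

/-- Weakly polyharmonic functions are smooth and satisfy Cauchy estimates with the sup norm. -/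
theorem exists_cauchy_estimate (m : ℕ) (F : Type*) [NormedAddCommGroup F] [NormedSpace ℝ F]
    [CompleteSpace F] (N : ℕ) (α : Fin m → ℕ) :
    ∃ C : ℝ, 0 ≤ C ∧ ∀ (Ω : Set (Euc m)) (g : Euc m → F), IsOpen Ω →
      IsWeaklyPolyharmonic N Ω g → ContDiffOn ℝ ∞ g Ω ∧
      ∀ (y : Euc m) (r B : ℝ), 0 < r → closedBall y r ⊆ Ω → (∀ x ∈ ball y r, ‖g x‖ ≤ B) →
        ‖iterCoordDeriv α (List.finRange m) g y‖ ≤ C * B / r ^ (∑ i, α i) := by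
  obtain ⟨ψ, hψ, hs, hrep⟩ := exists_reproducing_kernel m F N
  have hψc : HasCompactSupport ψ := HasCompactSupport.of_support_subset_isCompact
    (isCompact_closedBall 0 (1 / 2)) (subset_closure.trans hs)
  have hker : ∀ ρ : ℝ, 0 < ρ → ContDiff ℝ ∞ (fun z : Euc m => (ρ ^ m)⁻¹ * ψ (ρ⁻¹ • z)) ∧
      HasCompactSupport (fun z : Euc m => (ρ ^ m)⁻¹ * ψ (ρ⁻¹ • z)) := fun ρ hρ =>
    ⟨contDiff_const.mul (hψ.comp (contDiff_id.const_smul ρ⁻¹)),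
      (hψc.comp_smul (inv_ne_zero hρ.ne')).mul_left⟩
  have hGint : ∀ (Ω : Set (Euc m)) (g : Euc m → F), IsWeaklyPolyharmonic N Ω g →
      ∀ y r, closedBall y r ⊆ Ω → Integrable ((ball y r).indicator g) := by
    intro Ω g hg y r hy
    refine (integrable_indicator_iff isOpen_ball.measurableSet).2 ?_
    exact ((hg.continuousOn.mono hy).integrableOn_compact (isCompact_closedBall _ _)).mono_set
      ball_subset_closedBall
  set l := List.finRange m
  have hl : (l.map α).sum = ∑ i, α i := by
    rw [← List.ofFn_eq_map, List.sum_ofFn]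
  set D := iterCoordDeriv α l ψ with hD
  refine ⟨2 ^ (∑ i, α i) * ∫ z, ‖D z‖,
    mul_nonneg (by positivity) (integral_nonneg fun _ => norm_nonneg _),
    fun Ω g hΩ hg => ⟨fun y hy => ?_, ?_⟩⟩
  · obtain ⟨r, hr, hyr⟩ := nhds_basis_closedBall.mem_iff.1 (hΩ.mem_nhds hy)
    have he := eventuallyEq_convolution_of_reproducing hs (hrep Ω g hΩ hg) (half_pos hr)
      (by rwa [mul_div_cancel₀ r two_ne_zero])
    have hc := (hker (r / 2) (half_pos hr)).2.contDiff_convolution_left (n := ⊤)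
      (ContinuousLinearMap.lsmul ℝ ℝ : ℝ →L[ℝ] F →L[ℝ] F) (hker (r / 2) (half_pos hr)).1
      (hGint Ω g hg y (2 * (r / 2))
        (by rwa [mul_div_cancel₀ r two_ne_zero])).locallyIntegrable
    exact (hc.contDiffAt.congr_of_eventuallyEq he).contDiffWithinAt
  · intro y r B hr hyr hB
    set ρ := r / 2 with hρdef
    have hρ : 0 < ρ := half_pos hr
    have h2 : 2 * ρ = r := mul_div_cancel₀ r two_ne_zero
    rw [← h2] at hyr hB
    have hB0 : 0 ≤ B := (norm_nonneg _).trans (hB y (mem_ball_self (by linarith)))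
    have he := eventuallyEq_convolution_of_reproducing hs (hrep Ω g hΩ hg) hρ hyr
    rw [(iterCoordDeriv_eventuallyEq he α l).eq_of_nhds,
      iterCoordDeriv_convolution (hker ρ hρ).1 (hker ρ hρ).2
        (hGint Ω g hg y _ hyr).locallyIntegrable, iterCoordDeriv_const_mul_comp_smul, hl]
    have hcv := Measure.integral_comp_inv_smul (volume : Measure (Euc m)) (fun z => ‖D z‖) ρ
    rw [finrank_euclideanSpace_fin, abs_of_pos (by positivity), smul_eq_mul] at hcv
    have hDint : Integrable fun z => ‖D (ρ⁻¹ • z)‖ := by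
      have hDc : HasCompactSupport D := iterCoordDeriv_pred (P := fun g => HasCompactSupport g)
        (fun _ i h => hasCompactSupport_coordDeriv h i) α l hψc
      exact (((contDiff_iterCoordDeriv hψ α l).continuous.integrable_of_hasCompactSupport
        hDc).comp_smul (inv_ne_zero hρ.ne')).norm
    calc _ ≤ ∫ z, (ρ⁻¹ ^ (∑ i, α i) * (ρ ^ m)⁻¹ * B) * ‖D (ρ⁻¹ • z)‖ := by
          refine norm_integral_le_of_norm_le (hDint.const_mul _)
            (Eventually.of_forall fun z => ?_)
          simp only [ContinuousLinearMap.lsmul_apply, norm_smul, norm_mul]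
          rw [Real.norm_of_nonneg (by positivity : (0 : ℝ) ≤ ρ⁻¹ ^ (∑ i, α i)),
            Real.norm_of_nonneg (by positivity : (0 : ℝ) ≤ (ρ ^ m)⁻¹)]
          have hGB : ‖(ball y (2 * ρ)).indicator g (y - z)‖ ≤ B := by
            by_cases hz : y - z ∈ ball y (2 * ρ)
            · simpa [indicator_of_mem hz] using hB _ hz
            · simpa [indicator_of_notMem hz] using hB0
          calc _ ≤ ρ⁻¹ ^ (∑ i, α i) * ((ρ ^ m)⁻¹ * ‖D (ρ⁻¹ • z)‖) * B := by gcongr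
            _ = _ := by ring
      _ = _ := by
          rw [integral_const_mul, hcv, ← h2, mul_pow, inv_pow]
          field_simp

/-! ### Operator identities for two vector variables -/

section Algebra

variable {m : ℕ} {W : Type*} [AddCommGroup W] [Module ℝ W]

/-- Operators `E i`, `X i`, `U i`, `M i` that satisfy the relations of the left multiplications by
the generators `e_i`, of the derivatives `∂_{x_i}` and `∂_{u_i}`, and of the multiplications by the
coordinates `u_i`. -/
structure IsDiracSystem (E X U M : Fin m → Module.End ℝ W) : Prop where
  EE : ∀ i j w, E i (E j w) + E j (E i w) = if i = j then (-2 : ℝ) • w else 0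
  XX : ∀ i j, Commute (X i) (X j)
  XE : ∀ i j, Commute (X i) (E j)
  XU : ∀ i j, Commute (X i) (U j)
  XM : ∀ i j, Commute (X i) (M j)
  UE : ∀ i j, Commute (U i) (E j)
  ME : ∀ i j, Commute (M i) (E j)
  UM : ∀ i j, U i * M j = M j * U i + if i = j then 1 else 0

variable {E X U M : Fin m → Module.End ℝ W}

theorem IsDiracSystem.anticomm (h : IsDiracSystem E X U M) (i j : Fin m) :
    E i * E j + E j * E i = if i = j then (-2 : ℝ) • 1 else 0 := by
  refine LinearMap.ext fun w => (h.EE i j w).trans ?_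
  split_ifs <;> rfl

/-- The anticommutator of the Clifford vectors `∑ e_i P_i` and `∑ e_i Q_i` is `-2 ∑ P_i Q_i`. -/
theorem IsDiracSystem.sum_anticomm (h : IsDiracSystem E X U M) {P Q : Fin m → Module.End ℝ W}
    (hP : ∀ i j, Commute (P i) (E j)) (hQ : ∀ i j, Commute (Q i) (E j))
    (hPQ : ∀ i j, Commute (P i) (Q j)) :
    (∑ i, E i * P i) * (∑ i, E i * Q i) + (∑ i, E i * Q i) * (∑ i, E i * P i) =
      (-2 : ℝ) • ∑ i, P i * Q i := by
  have h1 : ∀ i j, E i * P i * (E j * Q j) + E j * Q j * (E i * P i) =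
      if i = j then (-2 : ℝ) • (P i * Q i) else 0 := by
    intro i j
    have e1 : E i * P i * (E j * Q j) = E i * E j * (P i * Q j) := by
      rw [mul_assoc, ← mul_assoc (P i), (hP i j).eq]; simp only [mul_assoc]
    have e2 : E j * Q j * (E i * P i) = E j * E i * (P i * Q j) := by
      rw [mul_assoc, ← mul_assoc (Q j), (hQ j i).eq, (hPQ i j).eq]; simp only [mul_assoc]
    rw [e1, e2, ← add_mul, h.anticomm]
    split_ifs with hij
    · rw [hij, smul_mul_assoc, one_mul]
    · rw [zero_mul]
  rw [Finset.sum_mul_sum, Finset.sum_mul_sum, Finset.sum_comm (s := Finset.univ)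
    (f := fun i j => E i * Q i * (E j * P j)), ← Finset.sum_add_distrib, Finset.smul_sum]
  refine Finset.sum_congr rfl fun i _ => ?_
  rw [← Finset.sum_add_distrib]
  simp only [h1]
  simp

/-- The commutation relation `L u = u L + D_x`, where `L = ⟨∂_u, ∂_x⟩`. -/
theorem IsDiracSystem.mixed_mul_vector (h : IsDiracSystem E X U M) :
    (∑ i, U i * X i) * (∑ i, E i * M i) =
      (∑ i, E i * M i) * (∑ i, U i * X i) + ∑ i, E i * X i := by
  have h1 : ∀ i j, U i * X i * (E j * M j) = E j * M j * (U i * X i) +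
      if i = j then E i * X i else 0 := by
    intro i j
    have e1 : U i * X i * (E j * M j) = E j * (U i * M j) * X i := by
      rw [mul_assoc, ← mul_assoc (X i), (h.XE i j).eq, mul_assoc (E j), (h.XM i j).eq,
        ← mul_assoc, (h.UE i j).eq]
      simp only [mul_assoc]
    rw [e1, h.UM, mul_add, add_mul]
    split_ifs with hij
    · subst hij; simp only [mul_one, mul_assoc]
    · simp only [mul_zero, zero_mul, mul_assoc]
  rw [Finset.sum_mul_sum, Finset.sum_mul_sum, Finset.sum_comm (s := Finset.univ)
    (f := fun i j => E i * M i * (U j * X j)), ← Finset.sum_add_distrib]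
  refine Finset.sum_congr rfl fun i _ => ?_
  simp only [h1, Finset.sum_add_distrib]
  simp

/-- The Rarita-Schwinger equation, written as `a D_x w = u ⟨∂_u, ∂_x⟩ w`, implies
`Δ_x^{k+1} w = 0`. -/
theorem IsDiracSystem.laplacian_pow_eq_zero (h : IsDiracSystem E X U M) (k : ℕ) {a : ℝ}
    (ha : (k : ℝ) < a) {w : W}
    (hw : a • (∑ i, E i * X i) w = (∑ i, E i * M i) ((∑ i, U i * X i) w))
    (hk : ((∑ i, U i * X i) ^ (k + 1)) w = 0) : ((∑ i, X i * X i) ^ (k + 1)) w = 0 := by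
  have hDD := h.sum_anticomm h.XE h.XE h.XX
  have hDu := h.sum_anticomm h.XE h.ME h.XM
  have hLu := h.mixed_mul_vector
  have hΔX : ∀ i, Commute (∑ i, X i * X i) (X i) := fun i =>
    Commute.sum_left _ _ _ fun j _ => (h.XX j i).mul_left (h.XX j i)
  have hΔ : ∀ P : Module.End ℝ W, (∀ i, Commute (X i) P) → Commute (∑ i, X i * X i) P :=
    fun P hP => Commute.sum_left _ _ _ fun j _ => (hP j).mul_left (hP j)
  have hΔD : Commute (∑ i, X i * X i) (∑ i, E i * X i) := hΔ _ fun i =>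
    Commute.sum_right _ _ _ fun j _ => (h.XE i j).mul_right (h.XX i j)
  have hΔu : Commute (∑ i, X i * X i) (∑ i, E i * M i) := hΔ _ fun i =>
    Commute.sum_right _ _ _ fun j _ => (h.XE i j).mul_right (h.XM i j)
  have hΔZ : Commute (∑ i, X i * X i) (∑ i, X i * M i) := hΔ _ fun i =>
    Commute.sum_right _ _ _ fun j _ => (h.XX i j).mul_right (h.XM i j)
  have hLD : Commute (∑ i, U i * X i) (∑ i, E i * X i) :=
    Commute.sum_left _ _ _ fun i _ => Commute.sum_right _ _ _ fun j _ =>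
      Commute.mul_left ((h.UE i j).mul_right (h.XU j i).symm) ((h.XE i j).mul_right (h.XX i j))
  generalize (∑ i, E i * X i) = D at *
  generalize (∑ i, U i * X i) = L at *
  generalize (∑ i, E i * M i) = u at *
  generalize (∑ i, X i * M i) = Z at *
  generalize (∑ i, X i * X i) = Δ at *
  have hΔ2 : Δ = -(D * D) := by
    have h2 : (2 : ℝ) • Δ = (2 : ℝ) • -(D * D) := by
      rw [smul_neg, two_smul ℝ (D * D), hDD, neg_smul, neg_neg]
    exact smul_right_injective _ (two_ne_zero' ℝ) h2
  induction k generalizing a w with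
  | zero =>
    have hL : L w = 0 := by simpa using hk
    rw [hL, map_zero] at hw
    have hD : D w = 0 := (smul_eq_zero.1 hw).resolve_left (by simpa using ha.ne')
    simp [hΔ2, hD]
  | succ k ih =>
    push_cast at ha
    -- `L w` solves the equation with `a - 1` in place of `a`
    have h1 : (a - 1) • D (L w) = u (L (L w)) := by
      have e := congrArg L hw
      have e2 := LinearMap.congr_fun hLu (L w)
      have e3 := LinearMap.congr_fun hLD.eq w
      simp only [Module.End.mul_apply, LinearMap.add_apply, map_smul] at e e2 e3
      rw [e2, e3] at e
      rw [sub_smul, e, one_smul, add_sub_cancel_right]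
    have h2 := ih (by linarith) (by rw [pow_succ] at hk; exact hk) h1
    have h3 : a • Δ w = (2 : ℝ) • Z (L w) + u (D (L w)) := by
      have e := LinearMap.congr_fun hDu (L w)
      simp only [Module.End.mul_apply, LinearMap.add_apply] at e
      rw [← hw] at e
      rw [LinearMap.smul_apply, neg_smul, ← add_eq_zero_iff_eq_neg] at e
      rw [hΔ2, LinearMap.neg_apply, Module.End.mul_apply, smul_neg, ← map_smul,
        neg_eq_iff_add_eq_zero, ← e]
      abel
    have h4 : a • (Δ ^ (k + 2)) w = 0 := by
      rw [pow_succ, Module.End.mul_apply, ← map_smul, h3, map_add, map_smul]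
      have c1 := LinearMap.congr_fun (hΔZ.pow_left (k + 1)).eq (L w)
      have c2 := LinearMap.congr_fun ((hΔu.mul_right hΔD).pow_left (k + 1)).eq (L w)
      simp only [Module.End.mul_apply] at c1 c2
      rw [c1, c2, h2]
      simp
    have ha0 : a ≠ 0 := ((add_nonneg k.cast_nonneg zero_le_one).trans_lt ha).ne'
    exact (smul_eq_zero.1 h4).resolve_left ha0

end Algebra

/-! ### Interpolation of homogeneous polynomials -/

/-- A finite-dimensional space of functions that are determined by their values on `s` has finitely
many nodes in `s` and functions that interpolate from these nodes. -/
theorem exists_interpolation {X : Type} (Q : Submodule ℝ (X → ℝ)) [FiniteDimensional ℝ Q]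
    (s : Set X) (hs : ∀ p ∈ Q, (∀ x ∈ s, p x = 0) → p = 0) :
    ∃ (J : Type) (_ : Fintype J) (node : J → X) (q : J → X → ℝ),
      (∀ j, node j ∈ s) ∧ (∀ j, q j ∈ Q) ∧ ∀ p ∈ Q, ∀ x, p x = ∑ j, q j x * p (node j) := by
  let ev : s → Module.Dual ℝ Q := fun x => (LinearMap.proj (x : X)).comp Q.subtype
  -- the evaluations at points of `s` span the dual space, since they separate the points of `Q`;
  -- expanding the coordinate functionals of a basis in evaluations gives the nodes
  have hspan : Submodule.span ℝ (range ev) = ⊤ := by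
    have h : (Submodule.span ℝ (range ev)).dualCoannihilator = ⊥ := by
      refine (Submodule.eq_bot_iff _).2 fun p hp => ?_
      rw [Submodule.mem_dualCoannihilator] at hp
      exact Subtype.ext (hs p p.2 fun x hx => hp (ev ⟨x, hx⟩) (Submodule.subset_span ⟨⟨x, hx⟩, rfl⟩))
    have h2 := Subspace.dualCoannihilator_dualAnnihilator_eq (W := Submodule.span ℝ (range ev))
    rw [← h2, h, Submodule.dualAnnihilator_bot]
  let b := Module.finBasis ℝ Q
  have hb : ∀ i, ∃ c : s →₀ ℝ, (c.sum fun x a => a • ev x) = b.coord i := fun i =>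
    Finsupp.mem_span_range_iff_exists_finsupp.1 (hspan ▸ Submodule.mem_top)
  choose c hc using hb
  refine ⟨Σ i, (c i).support, inferInstance, fun j => j.2.1, fun j => c j.1 j.2.1 • (b j.1 : X → ℝ),
    fun j => j.2.1.2, fun j => Q.smul_mem _ (b j.1).2, fun p hp x => ?_⟩
  have h1 := congrArg (fun p : Q => (p : X → ℝ) x) (b.sum_repr ⟨p, hp⟩)
  simp only [Submodule.coe_sum, Finset.sum_apply, Submodule.coe_smul, Pi.smul_apply,
    smul_eq_mul] at h1
  rw [← h1, Fintype.sum_sigma]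
  refine Finset.sum_congr rfl fun i _ => ?_
  have h2 := LinearMap.congr_fun (hc i) ⟨p, hp⟩
  rw [Module.Basis.coord_apply, Finsupp.sum, LinearMap.sum_apply] at h2
  rw [← h2, Finset.sum_mul, ← Finset.sum_coe_sort]
  refine Finset.sum_congr rfl fun y _ => ?_
  simp only [ev, LinearMap.smul_apply, LinearMap.comp_apply, Submodule.subtype_apply,
    LinearMap.proj_apply, smul_eq_mul, Pi.smul_apply]
  ring

/-- Homogeneous polynomials of degree `k` are interpolated by finitely many smooth homogeneous
functions from their values at nodes in the unit ball. -/
theorem exists_homogPoly_interpolation (m k : ℕ) :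
    ∃ (J : Type) (_ : Fintype J) (node : J → Euc m) (q : J → Euc m → ℝ),
      (∀ j, node j ∈ ball (0 : Euc m) 1) ∧ (∀ j, ContDiff ℝ ∞ (q j)) ∧
      (∀ j t u, q j (t • u) = t ^ k * q j u) ∧
      ∀ p : Euc m → Cl m, IsHomogPoly k p → ∀ u, p u = ∑ j, q j u • p (node j) := by
  let mon : (Finset.piAntidiag (Finset.univ : Finset (Fin m)) k) → Euc m → ℝ :=
    fun γ u => ∏ i, u i ^ (γ : Fin m → ℕ) i
  let Q : Submodule ℝ (Euc m → ℝ) := Submodule.span ℝ (range mon)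
  have hfin : FiniteDimensional ℝ Q := FiniteDimensional.span_of_finite ℝ (finite_range mon)
  have hsmooth : ∀ p ∈ Q, ContDiff ℝ ∞ p := by
    intro p hp
    induction hp using Submodule.span_induction with
    | mem p hp =>
      obtain ⟨γ, rfl⟩ := hp
      exact contDiff_prod fun i _ => (EuclideanSpace.proj (𝕜 := ℝ) i).contDiff.pow _
    | zero => exact contDiff_const
    | add p q _ _ hp hq => exact hp.add hq
    | smul a p _ hp => exact contDiff_const.smul hp
  have hhom : ∀ p ∈ Q, ∀ (t : ℝ) u, p (t • u) = t ^ k * p u := by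
    intro p hp t u
    induction hp using Submodule.span_induction with
    | mem p hp =>
      obtain ⟨γ, rfl⟩ := hp
      have h := (Finset.mem_piAntidiag.1 γ.2).1
      simp only [mon, PiLp.smul_apply, smul_eq_mul, mul_pow, Finset.prod_mul_distrib,
        Finset.prod_pow_eq_pow_sum]
      rw [h]
    | zero => simp
    | add p q _ _ hp hq => simp [hp, hq, mul_add]
    | smul a p _ hp => simp [hp, mul_left_comm]
  have hsep : ∀ p ∈ Q, (∀ x ∈ ball (0 : Euc m) 1, p x = 0) → p = 0 := by
    intro p hp h
    funext u
    have hpos : 0 < ‖u‖ + 1 := by positivity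
    have h1 : (‖u‖ + 1)⁻¹ • u ∈ ball (0 : Euc m) 1 := by
      rw [mem_ball_zero_iff, norm_smul, norm_inv, Real.norm_of_nonneg hpos.le, inv_mul_lt_iff₀ hpos]
      linarith
    have h2 := h _ h1
    rw [hhom p hp] at h2
    exact (mul_eq_zero.1 h2).resolve_left (by positivity)
  obtain ⟨J, hJ, node, q, hnode, hq, hint⟩ := exists_interpolation Q _ hsep
  refine ⟨J, hJ, node, q, hnode, fun j => hsmooth _ (hq j), fun j => hhom _ (hq j), ?_⟩
  rintro p ⟨c, hc⟩ u
  have h1 : ∀ γ ∈ Finset.piAntidiag (Finset.univ : Finset (Fin m)) k, (∏ i, u i ^ γ i) • c γ =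
      ∑ j, q j u • (∏ i, node j i ^ γ i) • c γ := by
    intro γ hγ
    have := hint (mon ⟨γ, hγ⟩) (Submodule.subset_span ⟨_, rfl⟩) u
    simp only [mon] at this
    rw [this, Finset.sum_smul]
    exact Finset.sum_congr rfl fun j _ => mul_smul _ _ _
  rw [hc, Finset.sum_congr rfl h1, Finset.sum_comm]
  exact Finset.sum_congr rfl fun j _ => by rw [hc, Finset.smul_sum]

/-! ### The operators on distributions with values in functions of the second variable -/

instance instFiniteDimensionalCl (m : ℕ) : FiniteDimensional ℝ (Cl m) :=
  Module.Finite.of_basis (bladeBasis m)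

instance instCompleteSpaceCl (m : ℕ) : CompleteSpace (Cl m) := FiniteDimensional.complete ℝ (Cl m)

/-- Left multiplication by a Clifford number as a continuous linear map. -/
noncomputable def mulLeftL {m : ℕ} (a : Cl m) : Cl m →L[ℝ] Cl m :=
  LinearMap.toContinuousLinearMap (LinearMap.mulLeft ℝ a)

@[simp] theorem mulLeftL_apply (a b : Cl m) : mulLeftL a b = a * b := rfl

/-- The partial derivative of test functions. -/
noncomputable def testDeriv (Ω : Set (Euc m)) (i : Fin m) : testFun Ω →ₗ[ℝ] testFun Ω where
  toFun φ := ⟨coordDeriv i φ, coordDeriv_mem_testFun φ.2 i⟩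
  map_add' φ χ := Subtype.ext (coordDeriv_add (φ.2.1.differentiable (by simp))
    (χ.2.1.differentiable (by simp)) i)
  map_smul' a φ := Subtype.ext (coordDeriv_const_smul a _ i)

/-- The space of smooth Clifford-valued functions. -/
def smoothFun (m : ℕ) : Submodule ℝ (Euc m → Cl m) where
  carrier := {p | ContDiff ℝ ∞ p}
  add_mem' := fun {p q} (hp : ContDiff ℝ ∞ p) (hq : ContDiff ℝ ∞ q) => hp.add hq
  zero_mem' := (contDiff_const : ContDiff ℝ ∞ fun _ : Euc m => (0 : Cl m))
  smul_mem' := fun c p (hp : ContDiff ℝ ∞ p) =>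
    (hp.const_smul c : ContDiff ℝ ∞ fun u => c • p u)

theorem contDiff_smoothFun (p : smoothFun m) : ContDiff ℝ ∞ (p : Euc m → Cl m) := p.2

theorem differentiable_smoothFun (p : smoothFun m) : Differentiable ℝ (p : Euc m → Cl m) :=
  (contDiff_smoothFun p).differentiable (by simp)

/-- The partial derivative of smooth Clifford-valued functions. -/
noncomputable def smoothDeriv (i : Fin m) : smoothFun m →ₗ[ℝ] smoothFun m where
  toFun p := ⟨coordDeriv i p, contDiff_coordDeriv (contDiff_smoothFun p) i⟩
  map_add' p q := Subtype.ext (coordDeriv_add (differentiable_smoothFun p) (differentiable_smoothFun q) i)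
  map_smul' a _ := Subtype.ext (coordDeriv_const_smul a _ i)

/-- Left multiplication by `e_i` on smooth Clifford-valued functions. -/
noncomputable def smoothGen (i : Fin m) : smoothFun m →ₗ[ℝ] smoothFun m where
  toFun p := ⟨fun u => gen i * (p : Euc m → Cl m) u, (mulLeftL (gen i)).contDiff.comp (contDiff_smoothFun p)⟩
  map_add' p q := Subtype.ext (funext fun u => mul_add (gen i) ((p : Euc m → Cl m) u) ((q : Euc m → Cl m) u))
  map_smul' a p := Subtype.ext (funext fun u => mul_smul_comm a (gen i) ((p : Euc m → Cl m) u))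

/-- Multiplication by the coordinate `u_i` on smooth Clifford-valued functions. -/
noncomputable def smoothCoord (i : Fin m) : smoothFun m →ₗ[ℝ] smoothFun m where
  toFun p := ⟨fun u => u i • (p : Euc m → Cl m) u,
    (EuclideanSpace.proj (𝕜 := ℝ) i).contDiff.smul (contDiff_smoothFun p)⟩
  map_add' p q := Subtype.ext (funext fun u => smul_add (u i) ((p : Euc m → Cl m) u) ((q : Euc m → Cl m) u))
  map_smul' a p := Subtype.ext (funext fun u => smul_comm (u i) a ((p : Euc m → Cl m) u))

theorem smoothGen_comp_add (i j : Fin m) (p : smoothFun m) :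
    smoothGen i (smoothGen j p) + smoothGen j (smoothGen i p) =
      if i = j then (-2 : ℝ) • p else 0 := by
  refine Subtype.ext (funext fun u => ?_)
  have h : gen i * (gen j * (p : Euc m → Cl m) u) + gen j * (gen i * (p : Euc m → Cl m) u) =
      if i = j then (-2 : ℝ) • (p : Euc m → Cl m) u else 0 := by
    rw [← mul_assoc, ← mul_assoc, ← add_mul]
    split_ifs with hij
    · subst hij
      rw [gen_mul_self, ← two_smul ℝ, smul_mul_assoc, neg_one_mul, smul_neg, neg_smul]
    · rw [gen_anticomm hij, neg_add_cancel, zero_mul]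
  rw [Submodule.coe_add, Pi.add_apply]
  refine Eq.trans h ?_
  split_ifs <;> rfl

theorem coordDeriv_gen_mul {p : Euc m → Cl m} (hp : Differentiable ℝ p) (i j : Fin m) :
    coordDeriv i (fun u => gen j * p u) = fun u => gen j * coordDeriv i p u := by
  funext u
  have h := (mulLeftL (gen j)).hasFDerivAt.comp u (hp u).hasFDerivAt
  rw [coordDeriv_eq_fderiv (hp u)]
  refine (coordDeriv_eq_fderiv h.differentiableAt i).trans ?_
  rw [h.fderiv]
  rfl

theorem smoothDeriv_coord (i j : Fin m) (p : smoothFun m) :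
    smoothDeriv i (smoothCoord j p) = smoothCoord j (smoothDeriv i p) + if i = j then p else 0 := by
  refine Subtype.ext (funext fun u => ?_)
  have hp : Differentiable ℝ (p : Euc m → Cl m) := differentiable_smoothFun p
  have h := ((EuclideanSpace.proj (𝕜 := ℝ) j).hasFDerivAt (x := u)).smul (hp u).hasFDerivAt
  have h2 : coordDeriv i (fun u : Euc m => u j • (p : Euc m → Cl m) u) u =
      u j • coordDeriv i p u + if i = j then (p : Euc m → Cl m) u else 0 := by
    rw [coordDeriv_eq_fderiv (hp u)]
    refine (coordDeriv_eq_fderiv h.differentiableAt i).trans ?_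
    erw [h.fderiv]
    by_cases hij : i = j
    · subst hij; simp
    · simp [hij]
  rw [Submodule.coe_add, Pi.add_apply]
  refine Eq.trans h2 ?_
  by_cases hij : i = j
  · simp only [hij, if_true]; rfl
  · simp only [hij, if_false]; rfl

/-- Distributions on `Ω` with values in the smooth functions of the variable `u`. Only the
linearity matters, no continuity is imposed. -/
abbrev VDistr (Ω : Set (Euc m)) : Type := testFun Ω →ₗ[ℝ] smoothFun m

/-- The operator `T ↦ (φ ↦ T (∂_i φ))`, which is `-∂_{x_i}`. The sign is immaterial: the
relations of a Dirac system and the equation for `T` are invariant under `X ↦ -X`. -/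
noncomputable def opX (Ω : Set (Euc m)) (i : Fin m) : Module.End ℝ (VDistr Ω) :=
  LinearMap.lcomp ℝ (smoothFun m) (testDeriv Ω i)

/-- The operator on distributions that is given by an operator in the variable `u`. -/
noncomputable def opVal (Ω : Set (Euc m)) (A : Module.End ℝ (smoothFun m)) :
    Module.End ℝ (VDistr Ω) :=
  LinearMap.compRight ℝ A

theorem isDiracSystem_op (Ω : Set (Euc m)) :
    IsDiracSystem (W := VDistr Ω) (fun i => opVal Ω (smoothGen i)) (opX Ω) (fun i => opVal Ω (smoothDeriv i))
      (fun i => opVal Ω (smoothCoord i)) where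
  EE i j T := by
    refine LinearMap.ext fun φ => (smoothGen_comp_add i j (T φ)).trans ?_
    split_ifs <;> rfl
  XX i j := by
    refine LinearMap.ext fun T => LinearMap.ext fun φ => ?_
    exact congrArg T (Subtype.ext (coordDeriv_comm φ.2.1 j i))
  XE i j := rfl
  XU i j := rfl
  XM i j := rfl
  UE i j := by
    refine LinearMap.ext fun T => LinearMap.ext fun φ => Subtype.ext ?_
    exact coordDeriv_gen_mul (differentiable_smoothFun (T φ)) i j
  ME i j := by
    refine LinearMap.ext fun T => LinearMap.ext fun φ => Subtype.ext (funext fun u => ?_)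
    exact (mul_smul_comm _ _ _).symm
  UM i j := by
    refine LinearMap.ext fun T => LinearMap.ext fun φ => ?_
    refine (smoothDeriv_coord i j (T φ)).trans ?_
    split_ifs <;> rfl

/-! ### Homogeneity in the second variable -/

/-- The values of `T` are homogeneous of degree `n`. The dilation by `0` is excluded, so that the
homogeneity passes to the derivatives by cancellation. -/
def IsHomogDistr {Ω : Set (Euc m)} (n : ℕ) (T : VDistr Ω) : Prop :=
  ∀ φ (t : ℝ) u, t ≠ 0 → (T φ : Euc m → Cl m) (t • u) = t ^ n • (T φ : Euc m → Cl m) u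

theorem mixed_apply {Ω : Set (Euc m)} (T : VDistr Ω) (φ : testFun Ω) (u : Euc m) :
    (((∑ i, opVal Ω (smoothDeriv i) * opX Ω i) T φ : smoothFun m) : Euc m → Cl m) u =
      ∑ i, coordDeriv i (T (testDeriv Ω i φ)) u := by
  rw [LinearMap.sum_apply, LinearMap.sum_apply, Submodule.coe_sum, Finset.sum_apply]
  rfl

/-- `⟨∂_u, ∂_x⟩` lowers the degree of homogeneity. -/
theorem IsHomogDistr.mixed {Ω : Set (Euc m)} {n : ℕ} {T : VDistr Ω} (hT : IsHomogDistr (n + 1) T) :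
    IsHomogDistr n ((∑ i, opVal Ω (smoothDeriv i) * opX Ω i) T) := by
  intro φ t u ht
  rw [mixed_apply, mixed_apply, Finset.smul_sum]
  refine Finset.sum_congr rfl fun i _ => ?_
  have h : (fun u => (T (testDeriv Ω i φ) : Euc m → Cl m) (t • u)) =
      t ^ (n + 1) • (T (testDeriv Ω i φ) : Euc m → Cl m) := funext fun u => hT _ t u ht
  have h2 := congrFun (congrArg (coordDeriv i) h) u
  rw [coordDeriv_comp_smul, coordDeriv_const_smul] at h2
  simp only [Pi.smul_apply, pow_succ', mul_smul] at h2
  exact smul_right_injective _ ht h2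

/-- A smooth function that is homogeneous of degree `0` is constant, by continuity at the
origin. -/
theorem IsHomogDistr.mixed_eq_zero {Ω : Set (Euc m)} {T : VDistr Ω} (hT : IsHomogDistr 0 T) :
    (∑ i, opVal Ω (smoothDeriv i) * opX Ω i) T = 0 := by
  refine LinearMap.ext fun φ => Subtype.ext (funext fun u => ?_)
  rw [mixed_apply]
  refine Finset.sum_eq_zero fun i _ => ?_
  set p := T (testDeriv Ω i φ) with hp
  have hconst : (p : Euc m → Cl m) = fun _ => (p : Euc m → Cl m) 0 := by
    funext v
    have hc : Continuous fun t : ℝ => (p : Euc m → Cl m) (t • v) :=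
      (contDiff_smoothFun p).continuous.comp (by fun_prop)
    have h1 : Tendsto (fun t : ℝ => (p : Euc m → Cl m) (t • v)) (𝓝[≠] 0)
        (𝓝 ((p : Euc m → Cl m) 0)) := by
      have := hc.tendsto 0
      rw [zero_smul] at this
      exact this.mono_left nhdsWithin_le_nhds
    refine tendsto_nhds_unique (tendsto_const_nhds.congr' ?_) h1
    filter_upwards [self_mem_nhdsWithin] with t ht
    rw [hp, hT _ t v ht, pow_zero, one_smul]
  rw [hconst]
  simp [coordDeriv, lineDeriv]

theorem IsHomogDistr.mixed_pow_eq_zero {Ω : Set (Euc m)} {n : ℕ} {T : VDistr Ω}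
    (hT : IsHomogDistr n T) : ((∑ i, opVal Ω (smoothDeriv i) * opX Ω i) ^ (n + 1)) T = 0 := by
  induction n generalizing T with
  | zero => rw [zero_add, pow_one, hT.mixed_eq_zero]
  | succ n ih => rw [pow_succ, Module.End.mul_apply, ih hT.mixed]

theorem laplacian_pow_apply {Ω : Set (Euc m)} (n : ℕ) (T : VDistr Ω) (φ : testFun Ω) :
    ((∑ i, opX Ω i * opX Ω i) ^ n) T φ =
      T ⟨lap^[n] φ, by
        induction n with
        | zero => exact φ.2
        | succ n ih => rw [Function.iterate_succ_apply']; exact lap_mem_testFun ih⟩ := by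
  induction n generalizing φ with
  | zero => rfl
  | succ n ih =>
    rw [pow_succ', Module.End.mul_apply, LinearMap.sum_apply, LinearMap.sum_apply]
    have h : ∀ i, (opX Ω i * opX Ω i) (((∑ i, opX Ω i * opX Ω i) ^ n) T) φ =
        ((∑ i, opX Ω i * opX Ω i) ^ n) T (testDeriv Ω i (testDeriv Ω i φ)) := fun i => rfl
    simp_rw [h]
    rw [← map_sum, ih]
    congr 1
    refine Subtype.ext ?_
    simp only [Function.iterate_succ_apply]
    congr 1
    rw [Submodule.coe_sum]
    funext x
    rw [Finset.sum_apply]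
    rfl

/-! ### The Rarita-Schwinger equation in the sense of distributions -/

section Weak

variable {J : Type} [Fintype J]

/-- The functional `d ↦ ∑ q_j (u) d_j` on families of Clifford numbers. -/
noncomputable def evalL (q : J → Euc m → ℝ) (u : Euc m) : (J → Cl m) →L[ℝ] Cl m :=
  ∑ j, q j u • ContinuousLinearMap.proj (R := ℝ) (φ := fun _ : J => Cl m) j

theorem evalL_apply (q : J → Euc m → ℝ) (u : Euc m) (d : J → Cl m) :
    evalL q u d = ∑ j, q j u • d j := by
  simp [evalL]

variable {q : J → Euc m → ℝ}

theorem contDiff_evalL (hq : ∀ j, ContDiff ℝ ∞ (q j)) (d : J → Cl m) :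
    ContDiff ℝ ∞ fun u => evalL q u d := by
  simp only [evalL_apply]
  exact ContDiff.sum fun j _ => (hq j).smul contDiff_const

theorem coordDeriv_evalL (hq : ∀ j, ContDiff ℝ ∞ (q j)) (d : J → Cl m) (i : Fin m) :
    coordDeriv i (fun u => evalL q u d) = fun u => evalL (fun j => coordDeriv i (q j)) u d := by
  have hd : ∀ j, Differentiable ℝ (q j) := fun j => (hq j).differentiable (by simp)
  funext u
  simp only [evalL_apply]
  rw [coordDeriv_sum fun j _ => ((hd j).smul_const (d j)) u]
  exact Finset.sum_congr rfl fun j _ => congrFun (coordDeriv_smul_const (hd j) (d j) i) u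

theorem iterCoordDeriv_evalL (hq : ∀ j, ContDiff ℝ ∞ (q j)) (d : J → Cl m) (α : Fin m → ℕ)
    (l : List (Fin m)) : iterCoordDeriv α l (fun u => evalL q u d) =
      fun u => evalL (fun j => iterCoordDeriv α l (q j)) u d := by
  induction l with
  | nil => rfl
  | cons i l ih =>
    have h : ∀ (n : ℕ) (q : J → Euc m → ℝ), (∀ j, ContDiff ℝ ∞ (q j)) →
        (coordDeriv i)^[n] (fun u => evalL q u d) =
          fun u => evalL (fun j => (coordDeriv i)^[n] (q j)) u d := by
      intro n
      induction n with
      | zero => intro q _; rfl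
      | succ n ihn =>
        intro q hq
        rw [Function.iterate_succ_apply, coordDeriv_evalL hq,
          ihn _ fun j => contDiff_coordDeriv (hq j) i]
        rfl
    change (coordDeriv i)^[α i] (iterCoordDeriv α l fun u => evalL q u d) = _
    rw [ih, h _ _ fun j => contDiff_iterCoordDeriv (hq j) α l]
    rfl

theorem integral_clm_smul {V V' : Type*} [NormedAddCommGroup V] [NormedSpace ℝ V]
    [CompleteSpace V] [NormedAddCommGroup V'] [NormedSpace ℝ V'] [CompleteSpace V']
    {Ω : Set (Euc m)} (hΩ : IsOpen Ω) {φ : Euc m → ℝ} (hφ : φ ∈ testFun Ω) {c : Euc m → V}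
    (hc : ContinuousOn c Ω) (A : V →L[ℝ] V') : ∫ x, φ x • A (c x) = A (∫ x, φ x • c x) := by
  rw [← A.integral_comp_comm (integrable_testFun_smul hΩ hφ hc)]
  simp only [map_smul]

/-- A first-order system with constant coefficients that holds pointwise holds weakly. -/
theorem sum_integral_coordDeriv_eq_zero {V V' : Type*} [NormedAddCommGroup V] [NormedSpace ℝ V]
    [CompleteSpace V] [NormedAddCommGroup V'] [NormedSpace ℝ V'] [CompleteSpace V']
    {Ω : Set (Euc m)} (hΩ : IsOpen Ω) {φ : Euc m → ℝ} (hφ : φ ∈ testFun Ω) {c : Euc m → V}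
    (hc : ContDiffOn ℝ 1 c Ω) (A : Fin m → V →L[ℝ] V')
    (h : ∀ x ∈ Ω, ∑ i, A i (coordDeriv i c x) = 0) :
    ∑ i, A i (∫ x, coordDeriv i (φ : Euc m → ℝ) x • c x) = 0 := by
  have h1 : ∀ i, A i (∫ x, coordDeriv i (φ : Euc m → ℝ) x • c x) = -∫ x, φ x • A i (coordDeriv i c x) := by
    intro i
    rw [integral_clm_smul hΩ hφ (continuousOn_coordDeriv hΩ hc i),
      integral_smul_coordDeriv hΩ hφ.1 hφ.2.1 hφ.2.2 hc i, map_neg, neg_neg]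
  simp_rw [h1]
  rw [Finset.sum_neg_distrib, ← integral_finsetSum, integral_eq_zero_of_ae, neg_zero]
  · refine Eventually.of_forall fun x => ?_
    simp only [← Finset.smul_sum, Pi.zero_apply]
    by_cases hx : x ∈ Ω
    · rw [h x hx, smul_zero]
    · rw [image_eq_zero_of_notMem_tsupport fun hx' => hx (hφ.2.2 hx'), zero_smul]
  · intro i _
    exact integrable_testFun_smul hΩ hφ
      ((A i).continuous.comp_continuousOn (continuousOn_coordDeriv hΩ hc i))

/-- The function `D_x f (x, ·)`, where `f (x, u) = ∑ q_j (u) c_j (x)` and `d i = ∂_i c (x)`. -/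
noncomputable def diracEval (q : J → Euc m → ℝ) (d : Fin m → J → Cl m) (u : Euc m) : Cl m :=
  ∑ i, gen i * evalL q u (d i)

theorem coordDeriv_diracEval (hq : ∀ j, ContDiff ℝ ∞ (q j)) (d : Fin m → J → Cl m) (l : Fin m) :
    coordDeriv l (diracEval q d) = diracEval (fun j => coordDeriv l (q j)) d := by
  have hd : ∀ i, Differentiable ℝ fun u => evalL q u (d i) := fun i =>
    (contDiff_evalL hq (d i)).differentiable (by simp)
  funext u
  unfold diracEval
  rw [coordDeriv_sum (g := fun i u => gen i * evalL q u (d i)) fun i _ =>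
    ((mulLeftL (gen i)).differentiable.comp (hd i)) u]
  refine Finset.sum_congr rfl fun i _ => ?_
  rw [coordDeriv_gen_mul (hd i), coordDeriv_evalL hq]

/-- `P_k D_x f (x, v)` depends linearly on the derivatives of the coefficients `c_j`. -/
theorem exists_fischerProj_diracEval (hq : ∀ j, ContDiff ℝ ∞ (q j)) (k : ℕ) (v : Euc m) :
    ∃ A : Fin m → (J → Cl m) →L[ℝ] Cl m, ∀ d,
      fischerProj k (diracEval q d) v = ∑ i, A i (d i) := by
  refine ⟨fun i => (mulLeftL (gen i)).comp (evalL q v) + ((m : ℝ) + 2 * k - 2)⁻¹ •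
    (mulLeftL (toCl v)).comp (∑ l, (mulLeftL (gen l)).comp ((mulLeftL (gen i)).comp
      (evalL (fun j => coordDeriv l (q j)) v))), fun d => ?_⟩
  simp only [fischerProj, dirac, partialDeriv_eq_coordDeriv, coordDeriv_diracEval hq, diracEval,
    add_apply, smul_apply, ContinuousLinearMap.comp_apply,
    sum_apply, mulLeftL_apply, Finset.sum_add_distrib, ← Finset.smul_sum,
    ← Finset.mul_sum]
  congr 3
  rw [Finset.sum_comm]
  exact Finset.sum_congr rfl fun l _ => Finset.mul_sum _ _ _

theorem fischerProj_homog {k : ℕ} {p : Euc m → Cl m} (hp : ∀ (t : ℝ) u, p (t • u) = t ^ k • p u)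
    (t : ℝ) (v : Euc m) : fischerProj k p (t • v) = t ^ k • fischerProj k p v := by
  have h : ∀ i, t • coordDeriv i p (t • v) = t ^ k • coordDeriv i p v := by
    intro i
    have h1 : (fun u => p (t • u)) = t ^ k • p := funext (hp t)
    have h2 := congrFun (congrArg (coordDeriv i) h1) v
    rwa [coordDeriv_comp_smul, coordDeriv_const_smul] at h2
  have h2 : toCl (t • v) * dirac p (t • v) = t ^ k • (toCl v * dirac p v) := by
    have : toCl (t • v) = t • toCl v := map_smul _ _ _
    rw [this, smul_mul_assoc, ← mul_smul_comm, ← mul_smul_comm]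
    congr 1
    simp only [dirac, Finset.smul_sum, partialDeriv_eq_coordDeriv]
    exact Finset.sum_congr rfl fun i _ => by rw [← mul_smul_comm, h, mul_smul_comm]
  rw [fischerProj, h2, hp, fischerProj, smul_add, smul_comm]

/-- The distribution `φ ↦ ∑ q_j (u) ∫ φ c_j`. -/
noncomputable def distrOf {Ω : Set (Euc m)} (hΩ : IsOpen Ω) (hq : ∀ j, ContDiff ℝ ∞ (q j))
    {c : Euc m → J → Cl m} (hc : ContinuousOn c Ω) : VDistr Ω where
  toFun φ := ⟨fun u => evalL q u (∫ x, (φ : Euc m → ℝ) x • c x), contDiff_evalL hq _⟩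
  map_add' φ χ := Subtype.ext (funext fun u => by
    have h : ∫ x, ((φ + χ : testFun Ω) : Euc m → ℝ) x • c x =
        ∫ x, (φ : Euc m → ℝ) x • c x + (χ : Euc m → ℝ) x • c x := by
      simp only [Submodule.coe_add, Pi.add_apply, add_smul]
    rw [h, integral_add (integrable_testFun_smul hΩ φ.2 hc) (integrable_testFun_smul hΩ χ.2 hc)]
    exact map_add _ _ _)
  map_smul' a φ := Subtype.ext (funext fun u => by
    have h : ∫ x, ((a • φ : testFun Ω) : Euc m → ℝ) x • c x =
        ∫ x, a • (φ : Euc m → ℝ) x • c x := by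
      simp only [Submodule.coe_smul, Pi.smul_apply, smul_assoc]
    rw [h, integral_smul]
    exact map_smul _ _ _)

theorem diracSum_apply {Ω : Set (Euc m)} (B : Fin m → Module.End ℝ (VDistr Ω)) (T : VDistr Ω)
    (φ : testFun Ω) (u : Euc m) :
    (((∑ i, opVal Ω (smoothGen i) * B i) T φ : smoothFun m) : Euc m → Cl m) u =
      ∑ i, gen i * (B i T φ : Euc m → Cl m) u := by
  rw [LinearMap.sum_apply, LinearMap.sum_apply, Submodule.coe_sum, Finset.sum_apply]
  rfl

/-- If `f (x, u) = ∑ q_j (u) c_j (x)` is monogenic in `u`, homogeneous of degree `k` in `u` and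
solves the Rarita-Schwinger equation, then `Δ_x^{k+1} f = 0` in the sense of distributions. -/
theorem evalL_integral_lap_eq_zero (hm : 3 ≤ m) (k : ℕ) {Ω : Set (Euc m)} (hΩ : IsOpen Ω)
    (hq : ∀ j, ContDiff ℝ ∞ (q j)) (hhom : ∀ j (t : ℝ) u, q j (t • u) = t ^ k * q j u)
    {c : Euc m → J → Cl m} (hc : ContDiffOn ℝ 1 c Ω)
    (hmon : ∀ x ∈ Ω, ∀ u, dirac (fun u => evalL q u (c x)) u = 0)
    (hrs : ∀ x ∈ Ω, ∀ v ∈ ball (0 : Euc m) 1,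
      fischerProj k (diracEval q fun i => coordDeriv i c x) v = 0)
    {φ : Euc m → ℝ} (hφ : φ ∈ testFun Ω) (u : Euc m) :
    evalL q u (∫ x, (lap^[k + 1] φ) x • c x) = 0 := by
  have hsys := isDiracSystem_op Ω
  have hEval : ∀ (t : ℝ) u d, evalL q (t • u) d = t ^ k • evalL q u d := by
    intro t u d
    simp only [evalL_apply, hhom, mul_smul, Finset.smul_sum]
  set T := distrOf hΩ hq hc.continuousOn with hT
  have hTφ : ∀ φ : testFun Ω, (T φ : Euc m → Cl m) =
      fun u => evalL q u (∫ x, (φ : Euc m → ℝ) x • c x) := fun φ => rfl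
  have hThom : IsHomogDistr k T := fun φ t u _ => hEval t u _
  have hDx : ∀ φ : testFun Ω, ((∑ i, opVal Ω (smoothGen i) * opX Ω i) T φ : Euc m → Cl m) =
      diracEval q fun i => ∫ x, coordDeriv i (φ : Euc m → ℝ) x • c x := by
    intro φ
    funext u
    rw [diracSum_apply]
    rfl
  -- `D_u T = 0`
  have hDu : (∑ i, opVal Ω (smoothGen i) * opVal Ω (smoothDeriv i)) T = 0 := by
    refine LinearMap.ext fun φ => Subtype.ext (funext fun u => ?_)
    rw [diracSum_apply]
    have h1 : ∀ i, ((opVal Ω (smoothDeriv i) T φ : smoothFun m) : Euc m → Cl m) u =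
        evalL (fun j => coordDeriv i (q j)) u (∫ x, (φ : Euc m → ℝ) x • c x) := by
      intro i
      have : ((opVal Ω (smoothDeriv i) T φ : smoothFun m) : Euc m → Cl m) =
        coordDeriv i fun u => evalL q u (∫ x, (φ : Euc m → ℝ) x • c x) := rfl
      rw [this, coordDeriv_evalL hq]
    have h2 := integral_clm_smul hΩ φ.2 hc.continuousOn
      (∑ i, (mulLeftL (gen i)).comp (evalL (fun j => coordDeriv i (q j)) u))
    simp only [sum_apply, ContinuousLinearMap.comp_apply,
      mulLeftL_apply] at h2
    simp_rw [h1]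
    rw [← h2]
    refine integral_eq_zero_of_ae (Eventually.of_forall fun x => ?_)
    by_cases hx : x ∈ Ω
    · have := hmon x hx u
      simp only [dirac, partialDeriv_eq_coordDeriv, coordDeriv_evalL hq] at this
      simp [this]
    · simp [image_eq_zero_of_notMem_tsupport fun hx' => hx (φ.2.2.2 hx')]
  have hFP : ∀ (φ : testFun Ω) (v : Euc m),
      fischerProj k (diracEval q fun i => ∫ x, coordDeriv i (φ : Euc m → ℝ) x • c x) v = 0 := by
    intro φ v
    -- the equation is given for `v` in the ball and extends by homogeneity
    have hball : ∀ v ∈ ball (0 : Euc m) 1,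
        fischerProj k (diracEval q fun i => ∫ x, coordDeriv i (φ : Euc m → ℝ) x • c x) v = 0 := by
      intro v hv
      obtain ⟨A, hA⟩ := exists_fischerProj_diracEval hq k v
      rw [hA]
      exact sum_integral_coordDeriv_eq_zero hΩ φ.2 hc A fun x hx => by
        rw [← hA fun i => coordDeriv i c x]; exact hrs x hx v hv
    have hpos : 0 < ‖v‖ + 1 := by positivity
    have h1 : (‖v‖ + 1)⁻¹ • v ∈ ball (0 : Euc m) 1 := by
      rw [mem_ball_zero_iff, norm_smul, norm_inv, Real.norm_of_nonneg hpos.le, inv_mul_lt_iff₀ hpos]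
      linarith
    have h2 := hball _ h1
    rw [fischerProj_homog fun t u => by
      simp only [diracEval, hEval, mul_smul_comm, Finset.smul_sum]] at h2
    exact (smul_eq_zero.1 h2).resolve_left (by positivity)
  have hm' : (3 : ℝ) ≤ m := by exact_mod_cast hm
  have hk' : (0 : ℝ) ≤ k := k.cast_nonneg
  set κ : ℝ := ((m : ℝ) + 2 * k - 2)⁻¹ with hκ
  have hκ0 : κ ≠ 0 := inv_ne_zero (by linarith)
  -- `(1 + κ u D_u) D_x T = 0`
  have hRS : (∑ i, opVal Ω (smoothGen i) * opX Ω i) T + κ •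
      (∑ i, opVal Ω (smoothGen i) * opVal Ω (smoothCoord i))
        ((∑ i, opVal Ω (smoothGen i) * opVal Ω (smoothDeriv i))
          ((∑ i, opVal Ω (smoothGen i) * opX Ω i) T)) = 0 := by
    refine LinearMap.ext fun φ => Subtype.ext (funext fun v => ?_)
    rw [LinearMap.add_apply, Submodule.coe_add, Pi.add_apply, LinearMap.smul_apply,
      Submodule.coe_smul, Pi.smul_apply, diracSum_apply]
    refine Eq.trans ?_ (hFP φ v)
    have h1 : ∀ (S : VDistr Ω), ∑ i, gen i * ((opVal Ω (smoothCoord i) S φ : smoothFun m) :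
        Euc m → Cl m) v = toCl v * (S φ : Euc m → Cl m) v := by
      intro S
      rw [toCl_eq_sum, Finset.sum_mul]
      refine Finset.sum_congr rfl fun i _ => ?_
      rw [smul_mul_assoc, ← mul_smul_comm]
      rfl
    have h2 : ∀ i (S : VDistr Ω), ((opVal Ω (smoothDeriv i) S φ : smoothFun m) : Euc m → Cl m) =
      coordDeriv i (S φ) := fun _ _ => rfl
    rw [diracSum_apply (fun i => opVal Ω (smoothCoord i)), h1, diracSum_apply]
    simp_rw [h2, hDx]
    rfl
  -- `D_u D_x T = -2 L T`, which turns the equation into the form `a D_x T = u L T`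
  have hanti := LinearMap.congr_fun (hsys.sum_anticomm hsys.UE hsys.XE
    fun i j => (hsys.XU j i).symm) T
  have hpow := hsys.laplacian_pow_eq_zero k (a := (2 * κ)⁻¹) (w := T) ?_ ?_
    hThom.mixed_pow_eq_zero
  · have h := congrArg (fun S : VDistr Ω => (S ⟨φ, hφ⟩ : Euc m → Cl m) u) hpow
    simp only [laplacian_pow_apply, hTφ] at h
    exact h
  · rw [hκ, mul_inv, inv_inv]
    linarith
  · simp only [LinearMap.add_apply, Module.End.mul_apply] at hanti
    rw [hDu, map_zero, add_zero] at hanti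
    rw [hanti] at hRS
    rw [LinearMap.smul_apply, map_smul, smul_smul] at hRS
    rw [inv_smul_eq_iff₀ (mul_ne_zero two_ne_zero hκ0), ← sub_eq_zero, ← hRS]
    module

end Weak

/-! ### Fermionic functions -/

/-- Monogenic functions are weakly harmonic: they are the fermionic functions of degree `0`. -/
theorem isWeaklyPolyharmonic_of_dirac_eq_zero (hm : 3 ≤ m) {Ω : Set (Euc m)} (hΩ : IsOpen Ω)
    {p : Euc m → Cl m} (hp : ContDiffOn ℝ 1 p Ω) (hd : ∀ x ∈ Ω, dirac p x = 0) :
    IsWeaklyPolyharmonic 1 Ω p := by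
  refine ⟨hp.continuousOn, fun φ hφ => ?_⟩
  let q : Unit → Euc m → ℝ := fun _ _ => 1
  let c : Euc m → Unit → Cl m := fun x _ => p x
  have hconst : ∀ (a : Cl m) u, dirac (fun _ : Euc m => a) u = 0 := by
    intro a u
    simp [dirac, partialDeriv, lineDeriv]
  have hc : ContDiffOn ℝ 1 c Ω := contDiffOn_pi.2 fun _ => hp
  have hq : ∀ u d, evalL q u d = d () := fun u d => by simp [evalL_apply, q]
  have h := evalL_integral_lap_eq_zero (q := q) (c := c) hm 0 hΩ (fun _ => contDiff_const)
    (by simp [q]) hc (fun x _ u => by simp only [hq]; exact hconst _ u) (fun x hx v _ => by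
      have h1 : diracEval q (fun i => coordDeriv i c x) = fun _ => 0 := by
        funext u
        rw [← hd x hx]
        refine Finset.sum_congr rfl fun i _ => ?_
        rw [hq, partialDeriv_eq_coordDeriv]
        congr 1
        beta_reduce
        have hc' : DifferentiableAt ℝ c x :=
          (hc.differentiableOn (by simp)).differentiableAt (hΩ.mem_nhds hx)
        have hp' : DifferentiableAt ℝ p x :=
          (hp.differentiableOn (by simp)).differentiableAt (hΩ.mem_nhds hx)
        rw [coordDeriv_eq_fderiv hc', coordDeriv_eq_fderiv hp', fderiv_pi fun _ => hp']
        rfl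
      rw [h1, fischerProj, hconst]
      simp) hφ 0
  rw [hq] at h
  rw [← h]
  exact integral_clm_smul hΩ
    (c := c) (lap_mem_testFun hφ) hc.continuousOn
    (ContinuousLinearMap.proj (R := ℝ) (φ := fun _ : Unit => Cl m) ())

/-- The separated form `f (x, u) = ∑ q_j (u) c_j (x)` of a fermionic function, and the weak
polyharmonicity of its derivatives in `u`. -/
theorem IsFermionic.evalL_properties (hm : 3 ≤ m) {k : ℕ} {J : Type} [Fintype J]
    {node : J → Euc m} {q : J → Euc m → ℝ} (hnode : ∀ j, node j ∈ ball (0 : Euc m) 1)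
    (hq : ∀ j, ContDiff ℝ ∞ (q j)) (hhom : ∀ j (t : ℝ) u, q j (t • u) = t ^ k * q j u)
    (hint : ∀ p : Euc m → Cl m, IsHomogPoly k p → ∀ u, p u = ∑ j, q j u • p (node j))
    {Ω : Set (Euc m)} (hΩ : IsOpen Ω) {f : Euc m × Euc m → Cl m} (hf : IsFermionic k Ω f) :
    (∀ x ∈ Ω, (∀ u ∈ ball (0 : Euc m) 1, f (x, u) = evalL q u fun j => f (x, node j)) ∧
      ∀ u, dirac (fun u => evalL q u fun j => f (x, node j)) u = 0) ∧
    ∀ (β : Fin m → ℕ) (l : List (Fin m)) (u : Euc m), IsWeaklyPolyharmonic (k + 1) Ω fun x =>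
      iterCoordDeriv β l (fun u => evalL q u fun j => f (x, node j)) u := by
  set c : Euc m → J → Cl m := fun x j => f (x, node j) with hcdef
  have hc : ContDiffOn ℝ 1 c Ω := contDiffOn_pi.2 fun j => hf.contDiffOn.comp
    (contDiff_id.prodMk contDiff_const).contDiffOn fun x hx => ⟨hx, hnode j⟩
  have hpx : ∀ x ∈ Ω, (∀ u ∈ ball (0 : Euc m) 1, f (x, u) = evalL q u (c x)) ∧
      ∀ u, dirac (fun u => evalL q u (c x)) u = 0 := by
    intro x hx
    obtain ⟨p, ⟨hp, hpd⟩, hfp⟩ := hf.mem_monogenicPoly x hx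
    have he : p = fun u => evalL q u (c x) := by
      funext u
      rw [hint p hp u, evalL_apply]
      exact Finset.sum_congr rfl fun j _ => by rw [hcdef]; simp only [hfp _ (hnode j)]
    exact ⟨fun u hu => by rw [hfp u hu, he], by rwa [← he]⟩
  refine ⟨hpx, fun β l u => ?_⟩
  have hrs : ∀ x ∈ Ω, ∀ v ∈ ball (0 : Euc m) 1,
      fischerProj k (diracEval q fun i => coordDeriv i c x) v = 0 := by
    intro x hx v hv
    rw [← hf.raritaSchwinger_eq_zero x hx v hv, raritaSchwinger]
    have hcx : HasFDerivAt c (fderiv ℝ c x) x :=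
      ((hc.differentiableOn (by simp)).differentiableAt (hΩ.mem_nhds hx)).hasFDerivAt
    have h1 : ∀ u ∈ ball (0 : Euc m) 1, diracEval q (fun i => coordDeriv i c x) u =
        dirac (fun x' => f (x', u)) x := by
      intro u hu
      refine Finset.sum_congr rfl fun i _ => ?_
      have he : (fun x' => f (x', u)) =ᶠ[𝓝 x] fun x' => evalL q u (c x') := by
        filter_upwards [hΩ.mem_nhds hx] with x' hx' using (hpx x' hx').1 u hu
      have h2 := (evalL q u).hasFDerivAt.comp x hcx
      beta_reduce
      rw [partialDeriv_eq_coordDeriv, coordDeriv_congr he, coordDeriv_eq_fderiv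
        hcx.differentiableAt]
      congr 1
      refine Eq.symm ((coordDeriv_eq_fderiv h2.differentiableAt i).trans ?_)
      rw [h2.fderiv]
      rfl
    have he : diracEval q (fun i => coordDeriv i c x) =ᶠ[𝓝 v]
        fun u => dirac (fun x' => f (x', u)) x := by
      filter_upwards [isOpen_ball.mem_nhds hv] with u hu using h1 u hu
    rw [fischerProj, fischerProj, h1 v hv]
    congr 3
    exact Finset.sum_congr rfl fun i _ => by
      rw [partialDeriv_eq_coordDeriv, partialDeriv_eq_coordDeriv, coordDeriv_congr he]
  simp only [iterCoordDeriv_evalL hq]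
  refine ⟨(ContinuousLinearMap.continuous _).comp_continuousOn hc.continuousOn, fun φ hφ => ?_⟩
  have hφ' : lap^[k + 1] φ ∈ testFun Ω := by
    generalize k + 1 = n
    induction n with
    | zero => exact hφ
    | succ n ih => rw [Function.iterate_succ_apply']; exact lap_mem_testFun ih
  rw [integral_clm_smul hΩ hφ' hc.continuousOn]
  -- the pairing with `Δ^{k+1} φ` vanishes identically in `u`, hence so do its derivatives in `u`
  have h0 : (fun u => evalL q u (∫ x, (lap^[k + 1] φ) x • c x)) = fun u => evalL q u 0 :=
    funext fun u => by
      rw [evalL_integral_lap_eq_zero hm k hΩ hq hhom hc (fun x hx => (hpx x hx).2) hrs hφ u,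
        map_zero]
  have h1 := congrFun (congrArg (iterCoordDeriv β l) h0) u
  rw [iterCoordDeriv_evalL hq, iterCoordDeriv_evalL hq] at h1
  simpa using h1

/-- For a bounded continuous function on an open set the essential supremum bounds every value. -/
theorem norm_le_eLpNorm_top {X F : Type*} [TopologicalSpace X] [MeasurableSpace X]
    [OpensMeasurableSpace X] [NormedAddCommGroup F] {μ : Measure X} [μ.IsOpenPosMeasure]
    {U : Set X} (hU : IsOpen U) {g : X → F} (hg : ContinuousOn g U) {C : ℝ}
    (hC : ∀ x ∈ U, ‖g x‖ ≤ C) {x : X} (hx : x ∈ U) :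
    ‖g x‖ ≤ (eLpNorm g ⊤ (μ.restrict U)).toReal := by
  have hfin : eLpNorm g ⊤ (μ.restrict U) ≠ ⊤ := by
    rw [eLpNorm_exponent_top]
    refine ((eLpNormEssSup_le_of_ae_bound (C := C) ?_).trans_lt ENNReal.ofReal_lt_top).ne
    filter_upwards [ae_restrict_mem hU.measurableSet] with y hy using hC y hy
  by_contra! hlt
  have hopen : IsOpen (U ∩ (fun y => ‖g y‖) ⁻¹' Ioi (eLpNorm g ⊤ (μ.restrict U)).toReal) :=
    hg.norm.isOpen_inter_preimage hU isOpen_Ioi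
  have hpos := hopen.measure_pos μ ⟨x, hx, hlt⟩
  have hae : ∀ᵐ y ∂(μ.restrict U), ‖g y‖ₑ ≤ eLpNorm g ⊤ (μ.restrict U) := by
    rw [eLpNorm_exponent_top]
    exact ae_le_eLpNormEssSup
  rw [ae_restrict_iff' hU.measurableSet] at hae
  refine hpos.ne' (measure_mono_null (fun y hy => ?_) hae)
  intro h
  have h2 := ENNReal.toReal_mono hfin (h hy.1)
  rw [toReal_enorm] at h2
  exact absurd hy.2 (not_lt.2 h2)

end RaritaSchwinger

open RaritaSchwinger
theorem mainTheorem3 (m : ℕ) (hm : 3 ≤ m) (k : ℕ) (α β : Fin m → ℕ) :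
    ∃ c : ℝ, ∀ (Ω : Set (Euc m)), IsOpen Ω → IsConnected Ω →
      ∀ f : Euc m × Euc m → Cl m, IsFermionic k Ω f →
        ContDiffOn ℝ ∞ f (Ω ×ˢ Metric.ball 0 1) ∧
        ∀ (y u : Euc m) (r₁ r₂ : ℝ), 0 < r₁ → 0 < r₂ →
          Metric.closedBall y r₁ ⊆ Ω → Metric.closedBall u r₂ ⊆ Metric.ball 0 1 →
          ‖mixedDeriv α β f y u‖ ≤
            c * (MeasureTheory.eLpNorm f ⊤ (MeasureTheory.volume.restrict
                (Metric.ball y r₁ ×ˢ Metric.ball u r₂))).toReal /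
              (r₁ ^ (∑ i, α i) * r₂ ^ (∑ i, β i)) := by
  obtain ⟨J, _, node, q, hnode, hq, hhom, hint⟩ := exists_homogPoly_interpolation m k
  obtain ⟨Cx, hCx, hx⟩ := exists_cauchy_estimate m (Cl m) (k + 1) α
  obtain ⟨Cu, hCu, hu⟩ := exists_cauchy_estimate m (Cl m) 1 β
  refine ⟨Cx * Cu, fun Ω hΩ _ f hf => ?_⟩
  obtain ⟨hsep, hweak⟩ := hf.evalL_properties hm hnode hq hhom hint hΩ
  refine ⟨?_, fun y u r₁ r₂ hr₁ hr₂ hy hu₂ => ?_⟩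
  · have hc : ∀ j, ContDiffOn ℝ ∞ (fun x => f (x, node j)) Ω := fun j =>
      ((hx Ω _ hΩ (hweak 0 [] (node j))).1).congr fun x hx => (hsep x hx).1 _ (hnode j)
    have hs : ContDiffOn ℝ ∞ (fun z : Euc m × Euc m => ∑ j, q j z.2 • f (z.1, node j))
        (Ω ×ˢ Metric.ball 0 1) := ContDiffOn.sum fun j _ =>
      ((hq j).comp contDiff_snd).contDiffOn.smul
        ((hc j).comp contDiff_fst.contDiffOn fun z hz => hz.1)
    refine hs.congr fun z hz => ?_
    rw [← evalL_apply]
    exact (hsep z.1 hz.1).1 z.2 hz.2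
  · set l := List.finRange m
    set B := (MeasureTheory.eLpNorm f ⊤ (MeasureTheory.volume.restrict
      (Metric.ball y r₁ ×ˢ Metric.ball u r₂))).toReal
    obtain ⟨C, hC⟩ := ((isCompact_closedBall y r₁).prod
      (isCompact_closedBall u r₂)).exists_bound_of_continuousOn
        (hf.contDiffOn.continuousOn.mono (Set.prod_mono hy hu₂))
    have hsub : Metric.ball y r₁ ×ˢ Metric.ball u r₂ ⊆
        Metric.closedBall y r₁ ×ˢ Metric.closedBall u r₂ :=
      Set.prod_mono Metric.ball_subset_closedBall Metric.ball_subset_closedBall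
    have hB : ∀ x ∈ Metric.ball y r₁, ∀ v ∈ Metric.ball u r₂, ‖f (x, v)‖ ≤ B :=
      fun x hx v hv => norm_le_eLpNorm_top (Metric.isOpen_ball.prod Metric.isOpen_ball)
        (hf.contDiffOn.continuousOn.mono (hsub.trans (Set.prod_mono hy hu₂)))
        (fun z hz => hC z (hsub hz)) ⟨hx, hv⟩
    have huΩ : u ∈ Metric.ball (0 : Euc m) 1 := hu₂ (Metric.mem_closedBall_self hr₂.le)
    -- the derivative in `u` is estimated first, at a fixed point `x`
    have hh : ∀ x ∈ Metric.ball y r₁,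
        ‖iterCoordDeriv β l (fun u => evalL q u fun j => f (x, node j)) u‖ ≤
          Cu * B / r₂ ^ (∑ i, β i) := by
      intro x hx
      have hxΩ : x ∈ Ω := hy (Metric.ball_subset_closedBall hx)
      have hw : IsWeaklyPolyharmonic 1 (Metric.ball (0 : Euc m) 1)
          (fun u => evalL q u fun j => f (x, node j)) :=
        isWeaklyPolyharmonic_of_dirac_eq_zero hm Metric.isOpen_ball
          ((contDiff_evalL hq _).of_le (by norm_cast)).contDiffOn fun v _ => (hsep x hxΩ).2 v
      refine (hu _ _ Metric.isOpen_ball hw).2 u r₂ B hr₂ hu₂ fun v hv => ?_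
      rw [← (hsep x hxΩ).1 v (hu₂ (Metric.ball_subset_closedBall hv))]
      exact hB x hx v hv
    have hmixed : mixedDeriv α β f y u = iterCoordDeriv α l (fun x =>
        iterCoordDeriv β l (fun u => evalL q u fun j => f (x, node j)) u) y := by
      refine (iterCoordDeriv_eventuallyEq ?_ α l).eq_of_nhds
      filter_upwards [hΩ.mem_nhds (hy (Metric.mem_closedBall_self hr₁.le))] with x hxΩ
      refine (iterCoordDeriv_eventuallyEq ?_ β l).eq_of_nhds
      filter_upwards [Metric.isOpen_ball.mem_nhds huΩ] with v hv using (hsep x hxΩ).1 v hv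
    rw [hmixed]
    refine ((hx Ω _ hΩ (hweak β l u)).2 y r₁ _ hr₁ hy hh).trans_eq ?_
    field_simp
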